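/- \textbf{Setting.} For every $n\ge 1$ let $\sigma_n>0$, let $F_0=F_0^{(n)}\in\mathbb R^n$ be an arbitrary vector, and let $\Phi=\Phi_n$ be a real $n\times k_n$ matrix of rank $k_n\le n$. Let $\langle\phi\rangle$ be the span of its columns, $\Pi=\Phi(\Phi^T\Phi)^{-1}\Phi^T$ the orthogonal projection onto $\langle\phi\rangle$, $\theta_0=(\Phi^T\Phi)^{-1}\Phi^TF_0$, and write $Y_\Phi=\Pi Y$, $F_\Phi=\Pi F_0=\Phi\theta_0$. Let $\widetilde W=\widetilde W_n$ be a probability measure on $\mathbb R^{k_n}$ and let $W$ be the image of $\widetilde W$ under $\theta\mapsto\Phi\theta$. For the Bayesian model $F\sim W$, $Y\mid F\sim\mathcal N(F,\sigma_n^2I_n)$, and a matrix $G$, let $W(\mathrm d(GF)\mid Y)$ denote the posterior distribution of $GF$ given $Y$. Let $\mathbb E$ denote expectation under the true law $Y\sim\mathcal N(F_0,\sigma_n^2I_n)$, and let $\|Q-Q'\|_{TV}=\sup_A|Q(A)-Q'(A)|$, the supremum being over measurable sets $A$. All limits are as $n\to\infty$. \textbf{Statement.} Let $p\ge1$ be fixed,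 and for each $n$ let $G=G_n$ be a real $p\times n$ matrix. Suppose that one of the following two sets of conditions holds. (A) (Isotropic Gaussian prior.) $W=\mathcal N(0,\tau_n^2\Pi)$ for a sequence $(\tau_n)$ such that $\sigma_n=o(\tau_n)$, $\|F_0\|=o(\tau_n^2/\sigma_n)$ and $k_n=o(\tau_n^4/\sigma_n^4)$. (B) (Smooth prior.) $\widetilde W$ has a density $w=w_n:\mathbb R^{k_n}\to[0,\infty)$ with respect to Lebesgue measure, and there is a sequence $M_n\to\infty$ such that \begin{enumerate} \item $\displaystyle\sup_{\|\Phi h\|^2\le\sigma_n^2M_n,\ \|\Phi g\|^2\le\sigma_n^2M_n}\frac{w(\theta_0+h)}{w(\theta_0+g)}\to1$; \item $k_n\ln k_n=o(M_n)$; \item $\displaystyle\max\Bigl(0,\ \ln\frac{\sqrt{\det(\Phi^T\Phi)}}{\sigma_n^{k_n}\,w(\theta_0)}\Bigr)=o(M_n)$. \end{enumerate} Then $$\mathbb E\,\bigl\|W(\mathrm d(GF)\mid Y)-\mathcal N\bigl(GY_\Phi,\ \sigma_n^2\,G\Pi G^T\bigr)\bigr\|_{TV}\longrightarrow0 .$$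 Moreover, for every $n$, when $Y\sim\mathcal N(F_0,\sigma_n^2I_n)$ the distribution of $GY_\Phi$ is $\mathcal N(GF_\Phi,\ \sigma_n^2\,G\Pi G^T)$. -/

import Mathlib

open MeasureTheory ProbabilityTheory Filter Topology
open scoped ENNReal NNReal Matrix

noncomputable section

namespace GaussianRegression

/-- The linear map `x ↦ A x` between Euclidean spaces given by a matrix `A`. -/
abbrev act {m n : ℕ} (A : Matrix (Fin m) (Fin n) ℝ) :
    EuclideanSpace ℝ (Fin n) →ₗ[ℝ] EuclideanSpace ℝ (Fin m) :=
  Matrix.toLpLin 2 2 A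

/-- The total variation distance `sup_A |μ(A) - ν(A)|` over measurable sets `A`
(used for probability measures only). -/
def tvDist {α : Type*} [MeasurableSpace α] (μ ν : Measure α) : ℝ≥0∞ :=
  ⨆ (A : Set α) (_ : MeasurableSet A), ENNReal.ofReal |μ.real A - ν.real A|

/-- The law `N(F, σ² Iₙ)` of the observation `Y = F + ε`, `ε ∼ N(0, σ² Iₙ)`. -/
def obsLaw {n : ℕ} (σ : ℝ) (F : EuclideanSpace ℝ (Fin n)) :
    Measure (EuclideanSpace ℝ (Fin n)) :=
  multivariateGaussian F (σ ^ 2 • (1 : Matrix (Fin n) (Fin n) ℝ))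

lemma measurable_obsLaw {n : ℕ} (σ : ℝ) :
    Measurable (fun F : EuclideanSpace ℝ (Fin n) => obsLaw σ F) := by
  have key (L : EuclideanSpace ℝ (Fin n) →L[ℝ] EuclideanSpace ℝ (Fin n)) :
      Measurable (fun F : EuclideanSpace ℝ (Fin n) =>
        (stdGaussian (EuclideanSpace ℝ (Fin n))).map (fun x => F + L x)) := by
    refine Measure.measurable_of_measurable_coe _ fun s hs => ?_
    have hmeas : Measurable (fun q : EuclideanSpace ℝ (Fin n) × EuclideanSpace ℝ (Fin n) =>
        q.1 + L q.2) := by fun_prop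
    have h := measurable_measure_prodMk_left (ν := stdGaussian (EuclideanSpace ℝ (Fin n)))
      (hmeas hs)
    have he : (fun F : EuclideanSpace ℝ (Fin n) =>
        (stdGaussian (EuclideanSpace ℝ (Fin n))).map (fun x => F + L x) s) =
        fun F => stdGaussian (EuclideanSpace ℝ (Fin n)) (Prod.mk F ⁻¹' ((fun q => q.1 + L q.2) ⁻¹' s)) := by
      funext F
      rw [Measure.map_apply (by fun_prop) hs]
      rfl
    rw [he]
    exact h
  exact key _

/-- The statistical model `F ↦ N(F, σ² Iₙ)` as a Markov kernel. -/
def model (n : ℕ) (σ : ℝ) :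
    Kernel (EuclideanSpace ℝ (Fin n)) (EuclideanSpace ℝ (Fin n)) where
  toFun F := obsLaw σ F
  measurable' := measurable_obsLaw σ

instance (n : ℕ) (σ : ℝ) : IsMarkovKernel (model n σ) where
  isProbabilityMeasure F := by
    change IsProbabilityMeasure (obsLaw σ F)
    unfold obsLaw
    infer_instance

/-- The prior `W` on `F = Φ θ` induced by a prior `W̃` on `θ`. -/
def inducedPrior {n k : ℕ} (Φ : Matrix (Fin n) (Fin k) ℝ)
    (Wt : Measure (EuclideanSpace ℝ (Fin k))) : Measure (EuclideanSpace ℝ (Fin n)) :=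
  Wt.map (act Φ)

instance {n k : ℕ} (Φ : Matrix (Fin n) (Fin k) ℝ)
    (Wt : Measure (EuclideanSpace ℝ (Fin k))) [IsProbabilityMeasure Wt] :
    IsProbabilityMeasure (inducedPrior Φ Wt) :=
  Measure.isProbabilityMeasure_map
    (LinearMap.continuous_of_finiteDimensional (act Φ)).measurable.aemeasurable

/-- The posterior distribution `W(d(G F) | Y = y)` of the linear functional `G F`, for the prior
`W` on `F` and the observation model `Y | F ∼ N(F, σ² Iₙ)`: the image under `G` of the conditional
law of `F` given `Y = y`. -/
def posteriorOf {n p : ℕ} (σ : ℝ) (W : Measure (EuclideanSpace ℝ (Fin n)))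
    [IsProbabilityMeasure W] (G : Matrix (Fin p) (Fin n) ℝ) (y : EuclideanSpace ℝ (Fin n)) :
    Measure (EuclideanSpace ℝ (Fin p)) :=
  (posterior (model n σ) W y).map (act G)

/-- The matrix `Π = Φ (Φᵀ Φ)⁻¹ Φᵀ` of the orthogonal projection onto the span of the
columns of `Φ` (these are assumed linearly independent wherever it is used). -/
def projMat {n k : ℕ} (Φ : Matrix (Fin n) (Fin k) ℝ) : Matrix (Fin n) (Fin n) ℝ :=
  Φ * (Φᵀ * Φ)⁻¹ * Φᵀ

/-- The parameter `θ₀ = (Φᵀ Φ)⁻¹ Φᵀ F₀` of the projection of `F₀`. -/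
def projParam {n k : ℕ} (Φ : Matrix (Fin n) (Fin k) ℝ) (F₀ : EuclideanSpace ℝ (Fin n)) :
    EuclideanSpace ℝ (Fin k) :=
  act ((Φᵀ * Φ)⁻¹ * Φᵀ) F₀

/-- Isotropic Gaussian priors: `W = N(0, τₙ² Π)`, with `σₙ = o(τₙ)`, `‖F₀‖ = o(τₙ² / σₙ)` and
`kₙ = o(τₙ⁴ / σₙ⁴)`. -/
def GaussianPriorConditions (k : ℕ → ℕ) (Φ : ∀ n, Matrix (Fin n) (Fin (k n)) ℝ) (σ : ℕ → ℝ)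
    (F₀ : ∀ n, EuclideanSpace ℝ (Fin n)) (Wt : ∀ n, Measure (EuclideanSpace ℝ (Fin (k n)))) :
    Prop :=
  ∃ τ : ℕ → ℝ,
    (∀ n, inducedPrior (Φ n) (Wt n) = multivariateGaussian 0 (τ n ^ 2 • projMat (Φ n))) ∧
    σ =o[atTop] τ ∧
    (fun n => ‖F₀ n‖) =o[atTop] (fun n => τ n ^ 2 / σ n) ∧
    (fun n => (k n : ℝ)) =o[atTop] (fun n => τ n ^ 4 / σ n ^ 4)

/-- The supremum of `w(θ₀ + h) / w(θ₀ + g)` over all `h`, `g` with `‖Φ h‖² ≤ r` and `‖Φ g‖² ≤ r`,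
in `[0, ∞]` (it is `∞` as soon as `w` vanishes somewhere, but not everywhere, on the ellipsoid,
and `0` if `w` vanishes on the whole ellipsoid). -/
def oscRatio {n k : ℕ} (Φ : Matrix (Fin n) (Fin k) ℝ) (w : EuclideanSpace ℝ (Fin k) → ℝ≥0)
    (θ₀ : EuclideanSpace ℝ (Fin k)) (r : ℝ) : ℝ≥0∞ :=
  ⨆ (h : EuclideanSpace ℝ (Fin k)) (_ : ‖act Φ h‖ ^ 2 ≤ r)
    (g : EuclideanSpace ℝ (Fin k)) (_ : ‖act Φ g‖ ^ 2 ≤ r),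
    (w (θ₀ + h) : ℝ≥0∞) / (w (θ₀ + g) : ℝ≥0∞)

/-- Smooth priors: `W̃` has a Lebesgue density `w` which is asymptotically flat on the ellipsoid
`‖Φ (θ - θ₀)‖² ≤ σₙ² Mₙ` and puts enough weight there, for some sequence `Mₙ → ∞` with
`kₙ ln kₙ = o(Mₙ)`. -/
def SmoothPriorConditions (k : ℕ → ℕ) (Φ : ∀ n, Matrix (Fin n) (Fin (k n)) ℝ) (σ : ℕ → ℝ)
    (F₀ : ∀ n, EuclideanSpace ℝ (Fin n)) (Wt : ∀ n, Measure (EuclideanSpace ℝ (Fin (k n)))) :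
    Prop :=
  ∃ (w : ∀ n, EuclideanSpace ℝ (Fin (k n)) → ℝ≥0) (M : ℕ → ℝ),
    (∀ n, Measurable (w n)) ∧
    (∀ n, Wt n = volume.withDensity (fun θ => (w n θ : ℝ≥0∞))) ∧
    Tendsto M atTop atTop ∧
    Tendsto (fun n => oscRatio (Φ n) (w n) (projParam (Φ n) (F₀ n)) (σ n ^ 2 * M n))
      atTop (𝓝 1) ∧
    (fun n => (k n : ℝ) * Real.log (k n)) =o[atTop] M ∧
    (fun n => max 0 (Real.log (Real.sqrt ((Φ n)ᵀ * Φ n).det /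
      (σ n ^ k n * (w n (projParam (Φ n) (F₀ n)) : ℝ))))) =o[atTop] M

end GaussianRegression

end

namespace GaussianRegression

/-! Write `Φ = U * T` with `U` having orthonormal columns and `T` invertible. In the coordinate `x =
T θ` the prior has a Lebesgue density `v`. By Pythagoras the likelihood of `y` at `F = U x` is, up
to a factor free of `x`, the density of `N(z, σ² I)` at `x`, where `z = Uᵀ y`. So the posterior of
`x` is `N(z, σ² I)` reweighted by `v`, and the limit law is the image of `N(z, σ² I)` under `G U`.
Total variation decreases under images, so it suffices to show that reweighting by `v` changes `N(z,
σ² I)` little, on average over `z ∼ N(Uᵀ F₀, σ² I)`. This reduction is `posterior_map_ae_eq` and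
`lintegral_tvDist_posteriorOf_le`; it removes `G`, `p` and the ambient dimension.

Gaussian prior: `v` is proportional to `exp(-‖x‖² / (2 τ²))`, and explicit Gaussian integrals bound
the ratio of its second moment to its squared mean by `exp X`, with `X = k σ⁴ / (2 τ⁴) + σ² ‖z‖² /
τ⁴`. A χ² type estimate (`tvDist_reweight_le_of_sq_integral_le`) bounds the distance by `c + X / c`
for every `c > 0`. This is linear in `X`, hence can be averaged over `z`.

Smooth prior: `v` is nearly constant on the ball of squared radius `σ² M` about `z₀ = Uᵀ F₀`.
Chebyshev's inequality, used both for `z` about `z₀` and for `x` about `z`, costs terms of order `k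
/ M`. Off the ball the Gaussian density is at most `σ^(-k) exp(-M / 8)` while `v` has mass at most
one; the condition on `w(θ₀)` makes this negligible against the value of `v` at `z₀`
(`tvDist_reweight_le_of_flat`, `tvDist_reweight_smooth_le`). -/

/-- A matrix with linearly independent columns factors as a matrix with orthonormal columns times
an invertible square matrix. -/
lemma exists_orthonormal_mul_invertible {n k : ℕ} (Φ : Matrix (Fin n) (Fin k) ℝ)
    (hΦ : LinearIndependent ℝ Φ.col) :
    ∃ (U : Matrix (Fin n) (Fin k) ℝ) (T : Matrix (Fin k) (Fin k) ℝ),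
      Uᵀ * U = 1 ∧ T.det ≠ 0 ∧ Φ = U * T := by
  have hpd : (Φᵀ * Φ).PosDef := by
    have h := Matrix.PosDef.conjTranspose_mul_self Φ (Matrix.mulVec_injective_iff.2 hΦ)
    simpa using h
  open scoped MatrixOrder in
  have hnn : 0 ≤ Φᵀ * Φ := hpd.posSemidef.nonneg
  -- Polar decomposition: `T` is the symmetric square root of the Gram matrix.
  obtain ⟨T, hT, hTT⟩ : ∃ T : Matrix (Fin k) (Fin k) ℝ, Tᵀ = T ∧ T * T = Φᵀ * Φ := by
    open scoped MatrixOrder in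
    refine ⟨CFC.sqrt (Φᵀ * Φ), ?_, CFC.sqrt_mul_sqrt_self _ hnn⟩
    open scoped MatrixOrder in
    have := (CFC.sqrt_nonneg (Φᵀ * Φ)).isSelfAdjoint
    simpa [Matrix.star_eq_conjTranspose] using this.star_eq
  have hdet : T.det ≠ 0 := by
    intro h
    have := hpd.det_pos
    rw [← hTT, Matrix.det_mul, h] at this
    simp at this
  have hu : IsUnit T.det := isUnit_iff_ne_zero.2 hdet
  refine ⟨Φ * T⁻¹, T, ?_, hdet, ?_⟩
  · rw [Matrix.transpose_mul, Matrix.transpose_nonsing_inv, hT, Matrix.mul_assoc,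
      ← Matrix.mul_assoc Φᵀ, ← hTT, Matrix.mul_assoc, Matrix.mul_nonsing_inv _ hu, Matrix.mul_one,
      Matrix.nonsing_inv_mul _ hu]
  · rw [Matrix.mul_assoc, Matrix.nonsing_inv_mul _ hu, Matrix.mul_one]

/-! ### Orthonormal coordinates on the span of the regressors. -/

section Factorization

variable {n k : ℕ} {U : Matrix (Fin n) (Fin k) ℝ} {T : Matrix (Fin k) (Fin k) ℝ}

/-- Source of both facts needed about `Φ = U * T`: multiplying by `U` gives `Π = U Uᵀ`, and applying
it to `F₀` gives `T θ₀ = Uᵀ F₀`. -/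
lemma inv_gram_mul (hU : Uᵀ * U = 1) (hT : T.det ≠ 0) :
    T * (((U * T)ᵀ * (U * T))⁻¹ * (U * T)ᵀ) = Uᵀ := by
  have hu : IsUnit T.det := isUnit_iff_ne_zero.2 hT
  have hut : IsUnit (Tᵀ).det := by rwa [Matrix.det_transpose]
  have : (U * T)ᵀ * (U * T) = Tᵀ * T := by
    rw [Matrix.transpose_mul, Matrix.mul_assoc, ← Matrix.mul_assoc Uᵀ, hU, Matrix.one_mul]
  rw [this, Matrix.mul_inv_rev, Matrix.transpose_mul, Matrix.mul_assoc T⁻¹, ← Matrix.mul_assoc Tᵀ⁻¹,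
    Matrix.nonsing_inv_mul _ hut, Matrix.one_mul, ← Matrix.mul_assoc, Matrix.mul_nonsing_inv _ hu,
    Matrix.one_mul]

lemma projMat_mul (hU : Uᵀ * U = 1) (hT : T.det ≠ 0) : projMat (U * T) = U * Uᵀ := by
  rw [projMat, Matrix.mul_assoc, Matrix.mul_assoc, inv_gram_mul hU hT]

lemma act_mul {a b c : ℕ} (A : Matrix (Fin a) (Fin b) ℝ) (B : Matrix (Fin b) (Fin c) ℝ)
    (x : EuclideanSpace ℝ (Fin c)) : act (A * B) x = act A (act B x) := by
  simp [act]

lemma act_one {a : ℕ} (x : EuclideanSpace ℝ (Fin a)) :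
    act (1 : Matrix (Fin a) (Fin a) ℝ) x = x := by
  simp [act]

lemma act_projParam_mul (hU : Uᵀ * U = 1) (hT : T.det ≠ 0) (F : EuclideanSpace ℝ (Fin n)) :
    act T (projParam (U * T) F) = act Uᵀ F := by
  rw [projParam, ← act_mul, inv_gram_mul hU hT]

lemma det_gram_mul (hU : Uᵀ * U = 1) : ((U * T)ᵀ * (U * T)).det = T.det ^ 2 := by
  rw [Matrix.transpose_mul, Matrix.mul_assoc, ← Matrix.mul_assoc Uᵀ, hU, Matrix.one_mul,
    Matrix.det_mul, Matrix.det_transpose, sq]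

lemma inner_act {a b : ℕ} (A : Matrix (Fin a) (Fin b) ℝ) (x : EuclideanSpace ℝ (Fin b))
    (y : EuclideanSpace ℝ (Fin a)) : inner ℝ (act A x) y = inner ℝ x (act Aᵀ y) := by
  simp only [EuclideanSpace.inner_eq_star_dotProduct, act, Matrix.toLpLin_apply, star_trivial,
    Matrix.mulVec_transpose]
  rw [Matrix.dotProduct_mulVec]

lemma norm_act (hU : Uᵀ * U = 1) (x : EuclideanSpace ℝ (Fin k)) : ‖act U x‖ = ‖x‖ := by
  have : ‖act U x‖ ^ 2 = ‖x‖ ^ 2 := by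
    rw [← real_inner_self_eq_norm_sq, ← real_inner_self_eq_norm_sq, inner_act, ← act_mul, hU,
      act_one]
  exact (sq_eq_sq₀ (norm_nonneg _) (norm_nonneg _)).1 this

lemma norm_act_transpose_le (hU : Uᵀ * U = 1) (y : EuclideanSpace ℝ (Fin n)) :
    ‖act Uᵀ y‖ ≤ ‖y‖ := by
  have h1 : ‖act Uᵀ y‖ ^ 2 ≤ ‖act Uᵀ y‖ * ‖y‖ := by
    have := real_inner_le_norm (act U (act Uᵀ y)) y
    rwa [inner_act, real_inner_self_eq_norm_sq, norm_act hU] at this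
  rcases (norm_nonneg (act Uᵀ y)).eq_or_lt with h | h
  · rw [← h]; exact norm_nonneg _
  · nlinarith

/-- Pythagoras: the bracket is the squared distance of `y` to the range of `U`, which does not
involve `x`. -/
lemma norm_sub_act_sq (hU : Uᵀ * U = 1) (y : EuclideanSpace ℝ (Fin n))
    (x : EuclideanSpace ℝ (Fin k)) :
    ‖y - act U x‖ ^ 2 = (‖y‖ ^ 2 - ‖act Uᵀ y‖ ^ 2) + ‖act Uᵀ y - x‖ ^ 2 := by
  rw [norm_sub_sq_real, norm_sub_sq_real, norm_act hU, real_inner_comm, inner_act,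
    real_inner_comm]
  ring

end Factorization

/-! ### Gaussian measures: linear images, densities, second moments. -/

lemma measurable_act {a b : ℕ} (A : Matrix (Fin a) (Fin b) ℝ) : Measurable (act A) :=
  (LinearMap.continuous_of_finiteDimensional (act A)).measurable

/-- Characteristic functions handle degenerate covariances too, which matters because `G Π Gᵀ` may
be singular. -/
lemma multivariateGaussian_map_act {a b : ℕ} (A : Matrix (Fin a) (Fin b) ℝ)
    (μ : EuclideanSpace ℝ (Fin b)) {S : Matrix (Fin b) (Fin b) ℝ} (hS : S.PosSemidef) :
    (multivariateGaussian μ S).map (act A) = multivariateGaussian (act A μ) (A * S * Aᵀ) := by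
  have hS' : (A * S * Aᵀ).PosSemidef := by
    simpa using hS.mul_mul_conjTranspose_same A
  have : IsProbabilityMeasure ((multivariateGaussian μ S).map (act A)) :=
    Measure.isProbabilityMeasure_map (measurable_act A).aemeasurable
  apply Measure.ext_of_charFun
  ext t
  rw [charFun_multivariateGaussian hS', charFun_apply,
    integral_map (measurable_act A).aemeasurable (by fun_prop)]
  simp_rw [inner_act]
  rw [← charFun_apply, charFun_multivariateGaussian hS, real_inner_comm, ← inner_act,
    real_inner_comm]
  congr 3
  simp only [act, Matrix.toLpLin_apply, ← Matrix.mulVec_mulVec, Matrix.dotProduct_mulVec,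
    Matrix.mulVec_transpose, Matrix.vecMul_vecMul, Matrix.mul_assoc]

lemma posSemidef_sq_smul_one (n : ℕ) (s : ℝ) :
    (s ^ 2 • (1 : Matrix (Fin n) (Fin n) ℝ)).PosSemidef :=
  Matrix.PosSemidef.one.smul (sq_nonneg s)

lemma obsLaw_map_act {a b : ℕ} (A : Matrix (Fin a) (Fin b) ℝ) (s : ℝ)
    (F : EuclideanSpace ℝ (Fin b)) :
    (obsLaw s F).map (act A) = multivariateGaussian (act A F) (s ^ 2 • (A * Aᵀ)) := by
  rw [obsLaw, multivariateGaussian_map_act A F (posSemidef_sq_smul_one b s)]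
  simp

/-- The Lebesgue density of `N(z, s² I)`. -/
noncomputable def gaussDensity {k : ℕ} (s : ℝ) (z x : EuclideanSpace ℝ (Fin k)) : ℝ :=
  (2 * Real.pi * s ^ 2) ^ (-(k : ℝ) / 2) * Real.exp (-‖x - z‖ ^ 2 / (2 * s ^ 2))

lemma gaussDensity_nonneg {k : ℕ} (s : ℝ) (z x : EuclideanSpace ℝ (Fin k)) :
    0 ≤ gaussDensity s z x := by
  unfold gaussDensity; positivity

lemma gaussDensity_pos {k : ℕ} {s : ℝ} (hs : 0 < s) (z x : EuclideanSpace ℝ (Fin k)) :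
    0 < gaussDensity s z x := by
  unfold gaussDensity; positivity

lemma continuous_gaussDensity {k : ℕ} (s : ℝ) :
    Continuous (fun q : EuclideanSpace ℝ (Fin k) × EuclideanSpace ℝ (Fin k) =>
      gaussDensity s q.1 q.2) := by
  unfold gaussDensity; fun_prop

lemma continuous_gaussDensity_right {k : ℕ} (s : ℝ) (z : EuclideanSpace ℝ (Fin k)) :
    Continuous (gaussDensity s z) := by
  change Continuous fun x => gaussDensity s z x
  unfold gaussDensity; fun_prop

lemma gaussDensity_comm {k : ℕ} (s : ℝ) (z x : EuclideanSpace ℝ (Fin k)) :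
    gaussDensity s z x = gaussDensity s x z := by
  rw [gaussDensity, gaussDensity, norm_sub_rev]

/-- The Laplace transform of an isotropic Gaussian weight. -/
lemma integral_exp_neg_mul_sq_norm_add_inner {k : ℕ} {b : ℝ} (hb : 0 < b)
    (w : EuclideanSpace ℝ (Fin k)) :
    ∫ x, Real.exp (-b * ‖x‖ ^ 2 + inner ℝ w x) =
      (Real.pi / b) ^ ((k : ℝ) / 2) * Real.exp (‖w‖ ^ 2 / (4 * b)) := by
  have h := GaussianFourier.integral_cexp_neg_mul_sq_norm_add (V := EuclideanSpace ℝ (Fin k))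
    (b := b) (by simpa using hb) 1 w
  rw [← Complex.ofReal_inj, ← integral_complex_ofReal]
  simp only [Complex.ofReal_exp, Complex.ofReal_mul, Complex.ofReal_add, Complex.ofReal_neg,
    Complex.ofReal_pow, Complex.ofReal_div]
  rw [Complex.ofReal_cpow (by positivity)]
  simpa using h

lemma integrable_exp_neg_mul_sq_norm_add_inner {k : ℕ} {b : ℝ} (hb : 0 < b)
    (w : EuclideanSpace ℝ (Fin k)) :
    Integrable (fun x => Real.exp (-b * ‖x‖ ^ 2 + inner ℝ w x)) := by
  have h := GaussianFourier.integrable_cexp_neg_mul_sq_norm_add (V := EuclideanSpace ℝ (Fin k))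
    (b := b) (by simpa using hb) 1 w
  refine h.re.congr (ae_of_all _ fun x => ?_)
  simp only [RCLike.re_to_complex, one_mul]
  rw [← Complex.ofReal_re (Real.exp _)]
  congr 1
  push_cast
  rfl

lemma integrable_gaussDensity {k : ℕ} {s : ℝ} (hs : 0 < s) (z : EuclideanSpace ℝ (Fin k)) :
    Integrable (gaussDensity s z) := by
  have hb : 0 < 1 / (2 * s ^ 2) := by positivity
  have := (integrable_exp_neg_mul_sq_norm_add_inner hb (0 : EuclideanSpace ℝ (Fin k))).const_mul
    ((2 * Real.pi * s ^ 2) ^ (-(k : ℝ) / 2))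
  refine (this.comp_sub_right z).congr (ae_of_all _ fun x => ?_)
  simp only [gaussDensity, inner_zero_left, add_zero]
  congr 2
  ring

lemma charFun_obsLaw {k : ℕ} (s : ℝ) (z t : EuclideanSpace ℝ (Fin k)) :
    charFun (obsLaw s z) t =
      Complex.exp ((inner ℝ t z : ℝ) * Complex.I - (s : ℂ) ^ 2 * (‖t‖ : ℂ) ^ 2 / 2) := by
  have h : (t : Fin k → ℝ) ⬝ᵥ (s ^ 2 • (1 : Matrix (Fin k) (Fin k) ℝ)) *ᵥ t = s ^ 2 * ‖t‖ ^ 2 := by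
    rw [← real_inner_self_eq_norm_sq, EuclideanSpace.inner_eq_star_dotProduct]
    simp [Matrix.smul_mulVec]
  rw [obsLaw, charFun_multivariateGaussian (posSemidef_sq_smul_one k s), h]
  push_cast
  rfl

lemma integral_gaussDensity_mul_cexp {k : ℕ} {s : ℝ} (hs : 0 < s)
    (z t : EuclideanSpace ℝ (Fin k)) :
    ∫ x, (gaussDensity s z x : ℂ) * Complex.exp ((inner ℝ x t : ℝ) * Complex.I) =
      Complex.exp ((inner ℝ t z : ℝ) * Complex.I - (s : ℂ) ^ 2 * (‖t‖ : ℂ) ^ 2 / 2) := by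
  have hb : 0 < 1 / (2 * s ^ 2) := by positivity
  rw [← integral_add_right_eq_self _ z]
  have key : ∀ x : EuclideanSpace ℝ (Fin k),
      (gaussDensity s z (x + z) : ℂ) * Complex.exp ((inner ℝ (x + z) t : ℝ) * Complex.I) =
      (((2 * Real.pi * s ^ 2) ^ (-(k : ℝ) / 2) : ℝ) * Complex.exp ((inner ℝ t z : ℝ) * Complex.I)) *
        Complex.exp (-((1 / (2 * s ^ 2) : ℝ) : ℂ) * ‖x‖ ^ 2 + Complex.I * (inner ℝ t x : ℝ)) := by
    intro x
    rw [gaussDensity, inner_add_left, real_inner_comm t x, real_inner_comm t z,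
      add_sub_cancel_right, Complex.ofReal_mul, Complex.ofReal_exp, mul_assoc (Complex.ofReal _),
      mul_assoc (Complex.ofReal _), ← Complex.exp_add, ← Complex.exp_add]
    congr 2
    push_cast
    ring
  simp_rw [key]
  rw [integral_const_mul, GaussianFourier.integral_cexp_neg_mul_sq_norm_add (by rwa [Complex.ofReal_re])]
  have h1 : ((Real.pi : ℂ) / ((1 / (2 * s ^ 2) : ℝ) : ℂ)) ^
      ((Module.finrank ℝ (EuclideanSpace ℝ (Fin k)) : ℂ) / 2) =
      (((2 * Real.pi * s ^ 2) ^ ((k : ℝ) / 2) : ℝ) : ℂ) := by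
    rw [Complex.ofReal_cpow (by positivity)]
    simp only [finrank_euclideanSpace, Fintype.card_fin]
    push_cast
    congr 1
    field_simp
  have h2 : ((2 * Real.pi * s ^ 2) ^ (-(k : ℝ) / 2) : ℝ) * (2 * Real.pi * s ^ 2) ^ ((k : ℝ) / 2)
      = 1 := by
    rw [← Real.rpow_add (by positivity), neg_div, neg_add_cancel, Real.rpow_zero]
  rw [h1, mul_mul_mul_comm, ← Complex.ofReal_mul, h2, Complex.ofReal_one, one_mul,
    ← Complex.exp_add, Complex.I_sq]
  congr 1
  have hs' : (s : ℂ) ≠ 0 := by exact_mod_cast hs.ne'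
  push_cast
  field_simp
  ring

instance isProbabilityMeasure_obsLaw {n : ℕ} (s : ℝ) (F : EuclideanSpace ℝ (Fin n)) :
    IsProbabilityMeasure (obsLaw s F) := by unfold obsLaw; infer_instance

/-- Both sides are finite measures with the same Fourier transform, by the Gaussian integral above.
-/
lemma obsLaw_eq_withDensity {k : ℕ} {s : ℝ} (hs : 0 < s) (z : EuclideanSpace ℝ (Fin k)) :
    obsLaw s z = volume.withDensity (fun x => ENNReal.ofReal (gaussDensity s z x)) := by
  have hc : Continuous (gaussDensity s z) := continuous_gaussDensity_right s z
  have hfin : IsFiniteMeasure (volume.withDensity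
      (fun x => ENNReal.ofReal (gaussDensity s z x))) :=
    isFiniteMeasure_withDensity_ofReal (integrable_gaussDensity hs z).2
  refine Measure.ext_of_charFun (funext fun t => ?_)
  rw [charFun_obsLaw, charFun_apply,
    integral_withDensity_eq_integral_toReal_smul (by fun_prop) (by simp),
    ← integral_gaussDensity_mul_cexp hs]
  refine integral_congr_ae (ae_of_all _ fun x => ?_)
  simp only [ENNReal.toReal_ofReal (gaussDensity_nonneg _ _ _), Complex.real_smul]

instance isGaussian_obsLaw {n : ℕ} (s : ℝ) (F : EuclideanSpace ℝ (Fin n)) :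
    IsGaussian (obsLaw s F) := by unfold obsLaw; infer_instance

lemma lintegral_sq_norm_sub_obsLaw {k : ℕ} (s : ℝ) (z : EuclideanSpace ℝ (Fin k)) :
    ∫⁻ x, ENNReal.ofReal (‖x - z‖ ^ 2) ∂(obsLaw s z) = ENNReal.ofReal (k * s ^ 2) := by
  have hi : ∀ i : Fin k, ∫⁻ x, ENNReal.ofReal ((x i - z i) ^ 2) ∂(obsLaw s z) =
      ENNReal.ofReal (s ^ 2) := by
    intro i
    have hS := posSemidef_sq_smul_one k s
    have hm : MemLp (fun x : EuclideanSpace ℝ (Fin k) => x i) 2 (obsLaw s z) :=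
      by
      simpa using (IsGaussian.memLp_two_id (μ := obsLaw s z)).continuousLinearMap_comp
        (EuclideanSpace.proj (𝕜 := ℝ) i)
    have hv := variance_eval_multivariateGaussian (μ := z) hS i
    have he : ∫ x, x i ∂(obsLaw s z) = z i := by
      have := (EuclideanSpace.proj (𝕜 := ℝ) i).integral_comp_id_comm
        (μ := obsLaw s z) IsGaussian.integrable_id
      simpa [obsLaw] using this
    have h1 := hm.ofReal_variance_eq
    rw [show Var[fun x : EuclideanSpace ℝ (Fin k) => x i; obsLaw s z] = s ^ 2 by
      simpa [obsLaw] using hv, evariance_eq_lintegral_ofReal, he] at h1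
    exact h1.symm
  simp_rw [EuclideanSpace.real_norm_sq_eq, PiLp.sub_apply]
  simp_rw [ENNReal.ofReal_sum_of_nonneg (fun _ _ => sq_nonneg _)]
  rw [lintegral_finsetSum _ (by fun_prop)]
  simp [hi, ENNReal.ofReal_mul]

/-! ### Calculus of normalized densities. -/

section Reweight

variable {α β : Type*} [MeasurableSpace α] [MeasurableSpace β]

/-- The measure `μ` with density `v`, normalized to have mass one. -/
noncomputable def reweight (μ : Measure α) (v : α → ℝ≥0∞) : Measure α :=
  (∫⁻ x, v x ∂μ)⁻¹ • μ.withDensity v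

lemma reweight_apply (μ : Measure α) (v : α → ℝ≥0∞) {s : Set α} (hs : MeasurableSet s) :
    reweight μ v s = (∫⁻ x, v x ∂μ)⁻¹ * ∫⁻ x in s, v x ∂μ := by
  rw [reweight, Measure.smul_apply, withDensity_apply _ hs, smul_eq_mul]

lemma reweight_univ_le (μ : Measure α) (v : α → ℝ≥0∞) : reweight μ v Set.univ ≤ 1 := by
  rw [reweight_apply _ _ MeasurableSet.univ, Measure.restrict_univ]
  exact ENNReal.inv_mul_le_one _

instance isFiniteMeasure_reweight (μ : Measure α) (v : α → ℝ≥0∞) :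
    IsFiniteMeasure (reweight μ v) :=
  ⟨(reweight_univ_le μ v).trans_lt ENNReal.one_lt_top⟩

lemma reweight_univ {μ : Measure α} {v : α → ℝ≥0∞} (h0 : ∫⁻ x, v x ∂μ ≠ 0)
    (h1 : ∫⁻ x, v x ∂μ ≠ ∞) : reweight μ v Set.univ = 1 := by
  rw [reweight_apply _ _ MeasurableSet.univ, Measure.restrict_univ, ENNReal.inv_mul_cancel h0 h1]

lemma reweight_const_mul (μ : Measure α) {v : α → ℝ≥0∞} (hv : Measurable v) {c : ℝ≥0∞}
    (hc : c ≠ 0) (hc' : c ≠ ∞) : reweight μ (fun x => c * v x) = reweight μ v := by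
  ext s hs
  rw [reweight_apply _ _ hs, reweight_apply _ _ hs, lintegral_const_mul _ hv,
    lintegral_const_mul _ hv, ENNReal.mul_inv (Or.inl hc) (Or.inl hc'), mul_mul_mul_comm,
    ENNReal.inv_mul_cancel hc hc', one_mul]

lemma reweight_map (μ : Measure α) {e : α → β} (he : Measurable e) {v : β → ℝ≥0∞}
    (hv : Measurable v) : reweight (μ.map e) v = (reweight μ (v ∘ e)).map e := by
  ext s hs
  rw [reweight_apply _ _ hs, Measure.map_apply he hs, reweight_apply _ _ (he hs),
    lintegral_map hv he, setLIntegral_map hs hv he]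
  rfl

/-- The symmetry behind the proof: the prior reweighted by the likelihood is also the Gaussian
likelihood reweighted by the prior density. -/
lemma reweight_withDensity_comm (μ : Measure α) {v w : α → ℝ≥0∞} (hv : Measurable v)
    (hw : Measurable w) : reweight (μ.withDensity v) w = reweight (μ.withDensity w) v := by
  ext s hs
  rw [reweight_apply _ _ hs, reweight_apply _ _ hs, lintegral_withDensity_eq_lintegral_mul _ hv hw,
    lintegral_withDensity_eq_lintegral_mul _ hw hv,
    setLIntegral_withDensity_eq_setLIntegral_mul _ hv hw hs,
    setLIntegral_withDensity_eq_setLIntegral_mul _ hw hv hs, mul_comm v w]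

end Reweight

/-! ### Bayes' formula and the posterior in orthonormal coordinates. -/

section Posterior

variable {n k : ℕ} {σ : ℝ}

lemma gaussDensity_le {k : ℕ} (s : ℝ) (z x : EuclideanSpace ℝ (Fin k)) :
    gaussDensity s z x ≤ (2 * Real.pi * s ^ 2) ^ (-(k : ℝ) / 2) := by
  rw [gaussDensity]
  refine mul_le_of_le_one_right (by positivity) (Real.exp_le_one_iff.2 ?_)
  rw [neg_div]
  exact neg_nonpos.2 (by positivity)

lemma lintegral_gaussDensity_ne_zero (hσ : 0 < σ) (W : Measure (EuclideanSpace ℝ (Fin n)))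
    [IsProbabilityMeasure W] (y : EuclideanSpace ℝ (Fin n)) :
    ∫⁻ F, ENNReal.ofReal (gaussDensity σ y F) ∂W ≠ 0 := by
  have hm : Measurable (gaussDensity σ y) := (continuous_gaussDensity_right σ y).measurable
  intro h
  rw [lintegral_eq_zero_iff (by fun_prop)] at h
  obtain ⟨F, hF⟩ := h.exists
  simp only [Pi.zero_apply, ENNReal.ofReal_eq_zero] at hF
  exact absurd hF (not_le.2 (gaussDensity_pos hσ y F))

lemma lintegral_gaussDensity_ne_top (σ : ℝ) (W : Measure (EuclideanSpace ℝ (Fin n)))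
    [IsProbabilityMeasure W] (y : EuclideanSpace ℝ (Fin n)) :
    ∫⁻ F, ENNReal.ofReal (gaussDensity σ y F) ∂W ≠ ∞ := by
  refine ne_top_of_le_ne_top
    (b := ENNReal.ofReal ((2 * Real.pi * σ ^ 2) ^ (-(n : ℝ) / 2))) ENNReal.ofReal_ne_top
    ((lintegral_mono fun F => ENNReal.ofReal_le_ofReal (gaussDensity_le σ y F)).trans ?_)
  simp

lemma measurable_ofReal_gaussDensity (n : ℕ) (σ : ℝ) :
    Measurable (Function.uncurry fun y F : EuclideanSpace ℝ (Fin n) =>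
      ENNReal.ofReal (gaussDensity σ y F)) :=
  (continuous_gaussDensity σ).measurable.ennreal_ofReal

/-- **Bayes' formula** for the Gaussian location model: the posterior has a density proportional
to the likelihood with respect to the prior. -/
lemma posterior_model_ae_eq (hσ : 0 < σ) (W : Measure (EuclideanSpace ℝ (Fin n)))
    [IsProbabilityMeasure W] (F₀ : EuclideanSpace ℝ (Fin n)) :
    ∀ᵐ y ∂(obsLaw σ F₀), posterior (model n σ) W y =
      reweight W (fun F => ENNReal.ofReal (gaussDensity σ y F)) := by
  set ℓ : EuclideanSpace ℝ (Fin n) → EuclideanSpace ℝ (Fin n) → ℝ≥0∞ :=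
    fun y F => ENNReal.ofReal (gaussDensity σ y F) with hℓ
  have hℓm : Measurable (Function.uncurry ℓ) := measurable_ofReal_gaussDensity n σ
  set m : EuclideanSpace ℝ (Fin n) → ℝ≥0∞ := fun y => ∫⁻ F, ℓ y F ∂W with hm
  have hmm : Measurable m := hℓm.lintegral_prod_right'
  have hm0 : ∀ y, m y ≠ 0 := lintegral_gaussDensity_ne_zero hσ W
  have hm1 : ∀ y, m y ≠ ∞ := lintegral_gaussDensity_ne_top σ W
  have hgm : Measurable (Function.uncurry fun y F => (m y)⁻¹ * ℓ y F) :=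
    (hmm.comp measurable_fst).inv.mul hℓm
  let η : Kernel (EuclideanSpace ℝ (Fin n)) (EuclideanSpace ℝ (Fin n)) :=
    Kernel.withDensity (Kernel.const _ W) (fun y F => (m y)⁻¹ * ℓ y F)
  have hη : ∀ y, η y = reweight W (ℓ y) := by
    intro y
    rw [Kernel.withDensity_apply _ hgm, Kernel.const_apply, reweight]
    exact withDensity_smul _ (hℓm.of_uncurry_left)
  have : IsMarkovKernel η := ⟨fun y => ⟨by rw [hη]; exact reweight_univ (hm0 y) (hm1 y)⟩⟩
  have hmodel : ∀ F, model n σ F = volume.withDensity (fun y => ℓ y F) := by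
    intro F
    change obsLaw σ F = _
    rw [obsLaw_eq_withDensity hσ]
    simp_rw [hℓ, gaussDensity_comm σ F]
  have hint : ∀ g : EuclideanSpace ℝ (Fin n) → EuclideanSpace ℝ (Fin n) → ℝ≥0∞,
      Measurable (Function.uncurry g) →
      ∫⁻ F, ∫⁻ y, g y F ∂(model n σ F) ∂W = ∫⁻ y, ∫⁻ F, ℓ y F * g y F ∂W := by
    intro g hg
    rw [lintegral_lintegral_swap (f := fun y F => ℓ y F * g y F) (hℓm.mul hg).aemeasurable]
    refine lintegral_congr fun F => ?_
    rw [hmodel, lintegral_withDensity_eq_lintegral_mul _ (hℓm.of_uncurry_right)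
      (hg.of_uncurry_right)]
    rfl
  have hbind : ∀ g : EuclideanSpace ℝ (Fin n) → ℝ≥0∞, Measurable g →
      ∫⁻ y, g y ∂((model n σ) ∘ₘ W) = ∫⁻ y, m y * g y := by
    intro g hg
    rw [Measure.lintegral_bind (model n σ).aemeasurable hg.aemeasurable,
      hint (fun y _ => g y) (hg.comp measurable_fst)]
    refine lintegral_congr fun y => ?_
    rw [lintegral_mul_const _ hℓm.of_uncurry_left]
  -- Tested against `f`, both joint laws give the integral of `ℓ y F * f (y, F)`: the marginal
  -- density `m y` cancels the normalization of `η`.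
  have hpost : η =ᵐ[(model n σ) ∘ₘ W] posterior (model n σ) W := by
    refine ae_eq_posterior_of_compProd_eq (Measure.ext_of_lintegral _ fun f hf => ?_)
    rw [Measure.lintegral_compProd hf, lintegral_map hf measurable_swap,
      Measure.lintegral_compProd (f := fun a => f a.swap) (hf.comp measurable_swap),
      hbind _ hf.lintegral_kernel_prod_right']
    simp only [Prod.swap_prod_mk]
    rw [hint (fun y F => f (y, F)) hf]
    refine lintegral_congr fun y => ?_
    rw [hη, reweight, lintegral_smul_measure, smul_eq_mul, ← mul_assoc,
      ENNReal.mul_inv_cancel (hm0 y) (hm1 y), one_mul,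
      lintegral_withDensity_eq_lintegral_mul _ hℓm.of_uncurry_left
        (show Measurable fun F => f (y, F) from hf.comp measurable_prodMk_left)]
    rfl
  -- The posterior is only determined almost everywhere for the marginal law of `Y`. As `m` vanishes
  -- nowhere, null sets of that law are Lebesgue null, hence null for the true law.
  have hac : obsLaw σ F₀ ≪ (model n σ) ∘ₘ W := by
    refine Measure.AbsolutelyContinuous.mk fun s hs h => ?_
    have h1 := hbind (s.indicator 1) (measurable_one.indicator hs)
    rw [lintegral_indicator_one hs, h, eq_comm,
      lintegral_eq_zero_iff (f := fun y => m y * s.indicator 1 y)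
        (hmm.mul (measurable_one.indicator hs))] at h1
    rw [obsLaw_eq_withDensity hσ]
    refine withDensity_absolutelyContinuous _ _ (measure_mono_null (fun y hy => ?_) h1)
    simpa [hy] using hm0 y
  filter_upwards [hac.ae_le hpost] with y hy
  rw [← hy, hη]

lemma gaussDensity_act {U : Matrix (Fin n) (Fin k) ℝ} (hU : Uᵀ * U = 1) (hσ : 0 < σ)
    (y : EuclideanSpace ℝ (Fin n)) :
    ∃ c : ℝ, 0 < c ∧ ∀ x, gaussDensity σ y (act U x) = c * gaussDensity σ (act Uᵀ y) x := by
  refine ⟨(2 * Real.pi * σ ^ 2) ^ (-(n : ℝ) / 2) / (2 * Real.pi * σ ^ 2) ^ (-(k : ℝ) / 2) *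
    Real.exp (-(‖y‖ ^ 2 - ‖act Uᵀ y‖ ^ 2) / (2 * σ ^ 2)), by positivity, fun x => ?_⟩
  have h : Real.exp (-‖act U x - y‖ ^ 2 / (2 * σ ^ 2)) =
      Real.exp (-(‖y‖ ^ 2 - ‖act Uᵀ y‖ ^ 2) / (2 * σ ^ 2)) *
        Real.exp (-‖x - act Uᵀ y‖ ^ 2 / (2 * σ ^ 2)) := by
    rw [← Real.exp_add, norm_sub_rev, norm_sub_act_sq hU, norm_sub_rev x]
    congr 1
    ring
  rw [gaussDensity, gaussDensity, h]
  have : (2 * Real.pi * σ ^ 2) ^ (-(k : ℝ) / 2) ≠ 0 := by positivity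
  field_simp

/-- The posterior for a prior carried by the range of an isometry, in the coordinates given by
this isometry. -/
lemma posterior_map_ae_eq {U : Matrix (Fin n) (Fin k) ℝ} (hU : Uᵀ * U = 1) (hσ : 0 < σ)
    {v : EuclideanSpace ℝ (Fin k) → ℝ≥0∞} (hv : Measurable v)
    (W : Measure (EuclideanSpace ℝ (Fin n))) [IsProbabilityMeasure W]
    (hW : W = (volume.withDensity v).map (act U)) (F₀ : EuclideanSpace ℝ (Fin n)) :
    ∀ᵐ y ∂(obsLaw σ F₀), posterior (model n σ) W y =
      (reweight (obsLaw σ (act Uᵀ y)) v).map (act U) := by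
  filter_upwards [posterior_model_ae_eq hσ W F₀] with y hy
  obtain ⟨c, hc, hcx⟩ := gaussDensity_act hU hσ y
  have hm : Measurable (gaussDensity σ y) := (continuous_gaussDensity_right σ y).measurable
  have hm' : Measurable (gaussDensity σ (act Uᵀ y)) :=
    (continuous_gaussDensity_right σ _).measurable
  rw [hy, hW, reweight_map _ (measurable_act U) hm.ennreal_ofReal, obsLaw_eq_withDensity hσ,
    ← reweight_withDensity_comm _ hv hm'.ennreal_ofReal,
    ← reweight_const_mul _ hm'.ennreal_ofReal (c := ENNReal.ofReal c) (by simpa using hc) (by simp)]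
  congr 2
  funext x
  rw [Function.comp_apply, hcx, ENNReal.ofReal_mul hc.le]

end Posterior

/-! ### Total variation bounds for reweighted measures. -/

section TotalVariation

variable {α β : Type*} [MeasurableSpace α] [MeasurableSpace β]

lemma tvDist_le_ofReal {μ ν : Measure α} {c : ℝ}
    (h : ∀ A, MeasurableSet A → |μ.real A - ν.real A| ≤ c) : tvDist μ ν ≤ ENNReal.ofReal c :=
  iSup₂_le fun A hA => ENNReal.ofReal_le_ofReal (h A hA)

lemma tvDist_map_le (μ ν : Measure α) {f : α → β} (hf : Measurable f) :
    tvDist (μ.map f) (ν.map f) ≤ tvDist μ ν := by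
  refine iSup₂_le fun A hA => ?_
  rw [map_measureReal_apply hf hA, map_measureReal_apply hf hA]
  exact le_iSup₂ (f := fun (A : Set α) (_ : MeasurableSet A) =>
    ENNReal.ofReal |μ.real A - ν.real A|) (f ⁻¹' A) (hf hA)

lemma tvDist_le_one {μ ν : Measure α} (hμ : μ Set.univ ≤ 1) (hν : ν Set.univ ≤ 1) :
    tvDist μ ν ≤ 1 := by
  rw [← ENNReal.ofReal_one]
  have key : ∀ ρ : Measure α, ρ Set.univ ≤ 1 → ∀ A, ρ.real A ≤ 1 := fun ρ hρ A =>
    ENNReal.toReal_le_of_le_ofReal zero_le_one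
      (by simpa using (measure_mono (Set.subset_univ A)).trans hρ)
  refine tvDist_le_ofReal fun A _ => ?_
  have h1 := key μ hμ A
  have h2 := key ν hν A
  have h3 : 0 ≤ μ.real A := measureReal_nonneg
  have h4 : 0 ≤ ν.real A := measureReal_nonneg
  exact abs_sub_le_iff.2 ⟨by linarith, by linarith⟩

/-- A version of the bound of the total variation distance by the `χ²` divergence, for a
reweighting of a probability measure. -/
lemma tvDist_reweight_le_of_sq_integral_le {Q : Measure α} [IsProbabilityMeasure Q] {f : α → ℝ}
    (hf0 : ∀ x, 0 ≤ f x) (hf : Integrable f Q) (hf2 : Integrable (fun x => f x ^ 2) Q)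
    (hpos : 0 < ∫ x, f x ∂Q) {X c : ℝ} (hX : 0 ≤ X) (hc : 0 < c)
    (h : ∫ x, f x ^ 2 ∂Q ≤ Real.exp X * (∫ x, f x ∂Q) ^ 2) :
    tvDist (reweight Q (fun x => ENNReal.ofReal (f x))) Q ≤ ENNReal.ofReal (c + X / c) := by
  -- For `X > 1` the bound exceeds `c + 1 / c ≥ 1` and is trivial; for `X ≤ 1` one may use `exp X ≤
  -- 1 + 2 X`.
  rcases le_or_gt X 1 with hX1 | hX1
  swap
  · refine (tvDist_le_one (reweight_univ_le _ _) (by simp)).trans ?_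
    rw [← ENNReal.ofReal_one]
    refine ENNReal.ofReal_le_ofReal ?_
    have : 1 / c ≤ X / c := by gcongr
    have h2 : 1 ≤ c + 1 / c := by
      rw [← sub_nonneg]
      have : c + 1 / c - 1 = ((c - 1) ^ 2 + c) / c := by field_simp; ring
      rw [this]; positivity
    linarith
  set m := ∫ x, f x ∂Q with hm
  have hg : Integrable (fun x => f x / m - 1) Q := (hf.div_const m).sub (integrable_const _)
  -- With `u = f x / m - 1`, this is `|u| ≤ c / 2 + u² / (2 c)`, expanded in powers of `f x`.
  have hbound : ∀ x, |f x / m - 1| ≤ (c + 1 / c) / 2 - f x / (m * c) +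
      f x ^ 2 / (2 * c * m ^ 2) := by
    intro x
    have h1 : (c + 1 / c) / 2 - f x / (m * c) + f x ^ 2 / (2 * c * m ^ 2) - |f x / m - 1| =
        (|f x / m - 1| - c) ^ 2 / (2 * c) := by
      have : (|f x / m - 1| - c) ^ 2 = (f x / m - 1) ^ 2 - 2 * c * |f x / m - 1| + c ^ 2 := by
        rw [sub_sq, sq_abs]; ring
      rw [this]
      field_simp
      ring
    have : 0 ≤ (|f x / m - 1| - c) ^ 2 / (2 * c) := by positivity
    linarith
  have hI1 : Integrable (fun x => (c + 1 / c) / 2 - f x / (m * c)) Q :=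
    (integrable_const _).sub (hf.div_const _)
  have hL1 : ∫ x, |f x / m - 1| ∂Q ≤ c + X / c := by
    refine (integral_mono hg.abs (hI1.add (hf2.div_const _)) hbound).trans ?_
    simp only [Pi.add_apply]
    rw [integral_add hI1 (hf2.div_const _), integral_sub (integrable_const _) (hf.div_const _),
      integral_div (m * c), integral_div (2 * c * m ^ 2), integral_const, probReal_univ, one_smul, ← hm]
    have hexp : Real.exp X ≤ 1 + 2 * X := by
      have := abs_le.1 (Real.abs_exp_sub_one_sub_id_le (x := X) (by rw [abs_of_nonneg hX]; exact hX1))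
      nlinarith
    have h1 : (∫ x, f x ^ 2 ∂Q) / (2 * c * m ^ 2) ≤ (1 + 2 * X) / (2 * c) := by
      rw [div_le_div_iff₀ (by positivity) (by positivity)]
      nlinarith [mul_le_mul_of_nonneg_right hexp (sq_nonneg m)]
    have h2 : (c + 1 / c) / 2 - m / (m * c) + (1 + 2 * X) / (2 * c) = c / 2 + X / c := by
      field_simp
      ring
    linarith
  refine tvDist_le_ofReal fun A hA => ?_
  have h1 : (reweight Q (fun x => ENNReal.ofReal (f x))).real A = (∫ x in A, f x ∂Q) / m := by
    rw [measureReal_def, reweight_apply _ _ hA,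
      ← ofReal_integral_eq_lintegral_ofReal hf (ae_of_all _ hf0),
      ← ofReal_integral_eq_lintegral_ofReal hf.integrableOn (ae_of_all _ hf0),
      ENNReal.toReal_mul, ENNReal.toReal_inv, ENNReal.toReal_ofReal hpos.le,
      ENNReal.toReal_ofReal (integral_nonneg hf0), div_eq_inv_mul]
  have h2 : (∫ x in A, f x ∂Q) / m - Q.real A = ∫ x in A, (f x / m - 1) ∂Q := by
    rw [integral_sub (hf.div_const m).integrableOn (integrable_const _), integral_div]
    simp
  rw [h1, h2]
  refine (abs_integral_le_integral_abs).trans ((setIntegral_le_integral hg.abs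
    (ae_of_all _ fun x => abs_nonneg _)).trans hL1)

/-- Reweighting a probability measure by a function which is almost constant on a set of
large mass changes it little, if the reweighted measure has little mass off this set. -/
lemma tvDist_reweight_le_of_flat {Q : Measure α} [IsProbabilityMeasure Q] {v : α → ℝ≥0∞}
    {B : Set α} (hB : MeasurableSet B) {w r ε δ : ℝ} (hw : 0 < w)
    (hr : 0 < r) (hlow : ∀ x ∈ B, ENNReal.ofReal (w / r) ≤ v x)
    (hup : ∀ x ∈ B, v x ≤ ENNReal.ofReal (r * w)) (hε : ε < 1)
    (hQB : Q.real Bᶜ ≤ ε) (hδ0 : 0 ≤ δ) (hδ : ∫⁻ x in Bᶜ, v x ∂Q ≤ ENNReal.ofReal (w * δ))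
    (h1r : 1 ≤ r ^ 2 / (1 - ε)) :
    tvDist (reweight Q v) Q ≤
      ENNReal.ofReal (r ^ 2 / (1 - ε) - 1 + r * δ / (1 - ε)) := by
  have hε' : 0 < 1 - ε := by linarith
  have hQB' : 1 - ε ≤ Q.real B := by
    have := probReal_add_probReal_compl (μ := Q) hB
    linarith
  have hupA : ∀ A, MeasurableSet A → ∫⁻ x in A, v x ∂Q ≤ ENNReal.ofReal (r * w * Q.real A + w * δ) := by
    intro A hA
    rw [← lintegral_inter_add_sdiff v A hB, ENNReal.ofReal_add (by positivity) (by positivity)]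
    refine add_le_add ?_ ((lintegral_mono_set fun x hx => hx.2).trans hδ)
    calc ∫⁻ x in A ∩ B, v x ∂Q ≤ ∫⁻ x in A ∩ B, ENNReal.ofReal (r * w) ∂Q :=
          setLIntegral_mono' (hA.inter hB) fun x hx => hup x hx.2
      _ = ENNReal.ofReal (r * w) * Q (A ∩ B) := by rw [setLIntegral_const]
      _ ≤ ENNReal.ofReal (r * w) * Q A := by gcongr; exact Set.inter_subset_left
      _ = ENNReal.ofReal (r * w * Q.real A) := by
          rw [ENNReal.ofReal_mul (p := r * w) (by positivity), ofReal_measureReal]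
  have hfin : ∫⁻ x, v x ∂Q ≠ ∞ := by
    have := hupA Set.univ MeasurableSet.univ
    rw [Measure.restrict_univ] at this
    exact ne_top_of_le_ne_top ENNReal.ofReal_ne_top this
  have hm : w / r * (1 - ε) ≤ (∫⁻ x, v x ∂Q).toReal := by
    rw [← ENNReal.ofReal_le_iff_le_toReal hfin]
    calc ENNReal.ofReal (w / r * (1 - ε)) ≤ ENNReal.ofReal (w / r * Q.real B) := by gcongr
      _ = ∫⁻ x in B, ENNReal.ofReal (w / r) ∂Q := by
          rw [setLIntegral_const, ENNReal.ofReal_mul (by positivity), ofReal_measureReal]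
      _ ≤ ∫⁻ x in B, v x ∂Q := setLIntegral_mono' hB hlow
      _ ≤ ∫⁻ x, v x ∂Q := setLIntegral_le_lintegral _ _
  have hm0 : 0 < w / r * (1 - ε) := by positivity
  have hne : ∫⁻ x, v x ∂Q ≠ 0 := by
    intro h0
    rw [h0, ENNReal.toReal_zero] at hm
    linarith
  have : IsProbabilityMeasure (reweight Q v) := ⟨reweight_univ hne hfin⟩
  have key : ∀ A, MeasurableSet A → (reweight Q v).real A - Q.real A ≤
      r ^ 2 / (1 - ε) - 1 + r * δ / (1 - ε) := by
    intro A hA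
    have h1 : (reweight Q v).real A ≤ (r * w * Q.real A + w * δ) / (w / r * (1 - ε)) := by
      rw [measureReal_def, reweight_apply _ _ hA, ENNReal.toReal_mul, ENNReal.toReal_inv,
        ← div_eq_inv_mul]
      exact div_le_div₀ (by positivity)
        (ENNReal.toReal_le_of_le_ofReal (by positivity) (hupA A hA)) hm0 hm
    have h2 : (r * w * Q.real A + w * δ) / (w / r * (1 - ε)) =
        r ^ 2 / (1 - ε) * Q.real A + r * δ / (1 - ε) := by
      field_simp
    have h3 : Q.real A ≤ 1 := measureReal_le_one
    -- Since `1 ≤ r ^ 2 / (1 - ε)`, the coefficient of `Q.real A` after subtraction is nonnegative,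
    -- so `Q.real A ≤ 1` may be used.
    nlinarith
  refine tvDist_le_ofReal fun A hA => abs_sub_le_iff.2 ⟨key A hA, ?_⟩
  -- Both measures are probabilities, so the upper bound on the complement is the missing lower
  -- bound.
  have h1 := key Aᶜ hA.compl
  rw [measureReal_compl hA, measureReal_compl hA, probReal_univ, probReal_univ] at h1
  linarith

end TotalVariation

/-- Reduction of the Bernstein-von Mises theorem for `G F` to a bound for the total variation
distance in orthonormal coordinates of the span of the regressors. -/
lemma lintegral_tvDist_posteriorOf_le {n k p : ℕ} {U : Matrix (Fin n) (Fin k) ℝ} (hU : Uᵀ * U = 1)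
    {σ : ℝ} (hσ : 0 < σ) {v : EuclideanSpace ℝ (Fin k) → ℝ≥0∞} (hv : Measurable v)
    (W : Measure (EuclideanSpace ℝ (Fin n))) [IsProbabilityMeasure W]
    (hW : W = (volume.withDensity v).map (act U)) (F₀ : EuclideanSpace ℝ (Fin n))
    (G : Matrix (Fin p) (Fin n) ℝ) {h : EuclideanSpace ℝ (Fin k) → ℝ≥0∞} (hh : Measurable h)
    (hle : ∀ z, tvDist (reweight (obsLaw σ z) v) (obsLaw σ z) ≤ h z) :
    ∫⁻ y, tvDist (posteriorOf σ W G y)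
      (multivariateGaussian (act G (act (U * Uᵀ) y)) (σ ^ 2 • (G * (U * Uᵀ) * Gᵀ)))
      ∂(obsLaw σ F₀) ≤ ∫⁻ z, h z ∂(obsLaw σ (act Uᵀ F₀)) := by
  have h1 : (obsLaw σ F₀).map (act Uᵀ) = obsLaw σ (act Uᵀ F₀) := by
    rw [obsLaw_map_act, Matrix.transpose_transpose, hU, obsLaw]
  -- Only the majorant `h` has to be measurable; measurability of the total variation distance in
  -- `y` is not needed.
  rw [← h1, lintegral_map hh (measurable_act _)]
  refine lintegral_mono_ae ?_
  filter_upwards [posterior_map_ae_eq hU hσ hv W hW F₀] with y hy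
  have h2 : multivariateGaussian (act G (act (U * Uᵀ) y)) (σ ^ 2 • (G * (U * Uᵀ) * Gᵀ)) =
      ((obsLaw σ (act Uᵀ y)).map (act U)).map (act G) := by
    have h3 : act G ∘ act U = act (G * U) := by
      funext x; rw [act_mul, Function.comp_apply]
    rw [Measure.map_map (measurable_act _) (measurable_act _), h3, obsLaw_map_act, act_mul, act_mul,
      Matrix.transpose_mul, Matrix.mul_assoc, Matrix.mul_assoc, Matrix.mul_assoc]
  rw [posteriorOf, hy, h2]
  exact (tvDist_map_le _ _ (measurable_act _)).trans
    ((tvDist_map_le _ _ (measurable_act _)).trans (hle _))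

/-! ### The isotropic Gaussian prior: explicit χ² computation. -/

section GaussianPrior

lemma lintegral_sq_norm_obsLaw_le {k : ℕ} (s : ℝ) (z : EuclideanSpace ℝ (Fin k)) :
    ∫⁻ x, ENNReal.ofReal (‖x‖ ^ 2) ∂(obsLaw s z) ≤
      ENNReal.ofReal (2 * (k * s ^ 2) + 2 * ‖z‖ ^ 2) := by
  have h : ∀ x : EuclideanSpace ℝ (Fin k), ENNReal.ofReal (‖x‖ ^ 2) ≤
      ENNReal.ofReal 2 * ENNReal.ofReal (‖x - z‖ ^ 2) + ENNReal.ofReal (2 * ‖z‖ ^ 2) := by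
    intro x
    rw [← ENNReal.ofReal_mul zero_le_two, ← ENNReal.ofReal_add (by positivity) (by positivity)]
    refine ENNReal.ofReal_le_ofReal ?_
    have h1 : ‖x‖ ≤ ‖x - z‖ + ‖z‖ := by simpa using norm_add_le (x - z) z
    nlinarith [sq_nonneg (‖x - z‖ - ‖z‖), norm_nonneg x]
  refine (lintegral_mono h).trans ?_
  rw [lintegral_add_right _ measurable_const, lintegral_const_mul _ (by fun_prop),
    lintegral_sq_norm_sub_obsLaw, lintegral_const, measure_univ, mul_one,
    ← ENNReal.ofReal_mul zero_le_two, ← ENNReal.ofReal_add (by positivity) (by positivity)]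

/-- The weight merges with the Gaussian density into a quadratic exponential with rate `t + 1 / (2
s²)` and linear term `z / s²`, to which the Laplace transform applies. -/
lemma integral_exp_neg_sq_norm_obsLaw {k : ℕ} {s : ℝ} (hs : 0 < s) {t : ℝ} (ht : 0 ≤ t)
    (z : EuclideanSpace ℝ (Fin k)) :
    ∫ x, Real.exp (-t * ‖x‖ ^ 2) ∂(obsLaw s z) =
      (1 + 2 * t * s ^ 2) ^ (-(k : ℝ) / 2) *
        Real.exp (-(t * ‖z‖ ^ 2) / (1 + 2 * t * s ^ 2)) := by
  have hm : Measurable (gaussDensity s z) := (continuous_gaussDensity_right s z).measurable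
  have hb : 0 < t + 1 / (2 * s ^ 2) := by positivity
  rw [obsLaw_eq_withDensity hs, integral_withDensity_eq_integral_toReal_smul (by fun_prop) (by simp)]
  have key : ∀ x : EuclideanSpace ℝ (Fin k),
      (ENNReal.ofReal (gaussDensity s z x)).toReal • Real.exp (-t * ‖x‖ ^ 2) =
      ((2 * Real.pi * s ^ 2) ^ (-(k : ℝ) / 2) * Real.exp (-‖z‖ ^ 2 / (2 * s ^ 2))) *
        Real.exp (-(t + 1 / (2 * s ^ 2)) * ‖x‖ ^ 2 + inner ℝ ((1 / s ^ 2) • z) x) := by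
    intro x
    rw [ENNReal.toReal_ofReal (gaussDensity_nonneg _ _ _), smul_eq_mul, gaussDensity,
      mul_assoc (_ ^ (-(k : ℝ) / 2)), mul_assoc (_ ^ (-(k : ℝ) / 2)), ← Real.exp_add,
      ← Real.exp_add, norm_sub_sq_real, real_inner_smul_left,
      real_inner_comm z x]
    congr 2
    field_simp
    ring
  simp_rw [key]
  rw [integral_const_mul, integral_exp_neg_mul_sq_norm_add_inner hb, mul_mul_mul_comm,
    ← Real.exp_add]
  congr 1
  · have h1 : Real.pi / (t + 1 / (2 * s ^ 2)) = (2 * Real.pi * s ^ 2) / (1 + 2 * t * s ^ 2) := by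
      field_simp
      ring
    rw [h1, Real.div_rpow (by positivity) (by positivity), ← mul_div_assoc,
      ← Real.rpow_add (by positivity), neg_div, neg_add_cancel, Real.rpow_zero,
      Real.rpow_neg (by positivity), one_div]
  · rw [norm_smul, Real.norm_of_nonneg (by positivity)]
    congr 1
    field_simp
    ring

/-- With `a = s² / τ²` and `q = ‖z‖² / τ²`, the ratio of the two sides without the exponential is
`((1 + a)² / (1 + 2 a))^(k / 2) * exp(q a / ((1 + a) (1 + 2 a)))`. The base is at most `1 + a² ≤
exp(a²)` and the last exponent is at most `a q`. -/
lemma sq_integral_exp_neg_sq_norm_obsLaw_le {k : ℕ} {s τ : ℝ} (hs : 0 < s) (hτ : τ ≠ 0)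
    (z : EuclideanSpace ℝ (Fin k)) :
    ∫ x, Real.exp (-(1 / (2 * τ ^ 2)) * ‖x‖ ^ 2) ^ 2 ∂(obsLaw s z) ≤
      Real.exp (k * (s ^ 4 / τ ^ 4) / 2 + s ^ 2 / τ ^ 4 * ‖z‖ ^ 2) *
        (∫ x, Real.exp (-(1 / (2 * τ ^ 2)) * ‖x‖ ^ 2) ∂(obsLaw s z)) ^ 2 := by
  have h2 : ∀ x : EuclideanSpace ℝ (Fin k), Real.exp (-(1 / (2 * τ ^ 2)) * ‖x‖ ^ 2) ^ 2 =
      Real.exp (-(1 / τ ^ 2) * ‖x‖ ^ 2) := by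
    intro x
    rw [← Real.exp_nat_mul]
    congr 1
    field_simp
    norm_num
  simp_rw [h2]
  rw [integral_exp_neg_sq_norm_obsLaw hs (by positivity),
    integral_exp_neg_sq_norm_obsLaw hs (by positivity)]
  set a : ℝ := s ^ 2 / τ ^ 2 with ha
  have ha0 : 0 < a := by positivity
  have e1 : 1 + 2 * (1 / τ ^ 2) * s ^ 2 = 1 + 2 * a := by rw [ha]; ring
  have e2 : 1 + 2 * (1 / (2 * τ ^ 2)) * s ^ 2 = 1 + a := by rw [ha]; field_simp
  have e3 : s ^ 4 / τ ^ 4 = a ^ 2 := by rw [ha]; field_simp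
  have e4 : s ^ 2 / τ ^ 4 * ‖z‖ ^ 2 = a * (‖z‖ ^ 2 / τ ^ 2) := by rw [ha]; field_simp
  have e5 : -(1 / τ ^ 2 * ‖z‖ ^ 2) / (1 + 2 * a) = -(‖z‖ ^ 2 / τ ^ 2) / (1 + 2 * a) := by ring
  have e6 : -(1 / (2 * τ ^ 2) * ‖z‖ ^ 2) / (1 + a) = -(‖z‖ ^ 2 / τ ^ 2) / (1 + a) / 2 := by
    field_simp
  rw [e1, e2, e3, e4, e5, e6]
  set q : ℝ := ‖z‖ ^ 2 / τ ^ 2 with hq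
  have hq0 : 0 ≤ q := by positivity
  rw [mul_pow, ← Real.exp_nat_mul, Real.exp_add, mul_mul_mul_comm, ← Real.exp_add]
  refine mul_le_mul ?_ (Real.exp_le_exp.2 ?_) (Real.exp_nonneg _) (by positivity)
  · have h3 : (1 + a) ^ 2 ≤ Real.exp (a ^ 2) * (1 + 2 * a) := by
      nlinarith [Real.add_one_le_exp (a ^ 2), pow_pos ha0 3]
    have h4 : ((1 + a) ^ 2) ^ ((k : ℝ) / 2) ≤ (Real.exp (a ^ 2) * (1 + 2 * a)) ^ ((k : ℝ) / 2) :=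
      Real.rpow_le_rpow (by positivity) h3 (by positivity)
    rw [Real.mul_rpow (by positivity) (by positivity), ← Real.exp_mul] at h4
    have h5 : ((1 + a) ^ (-(k : ℝ) / 2)) ^ 2 = (((1 + a) ^ 2) ^ ((k : ℝ) / 2))⁻¹ := by
      rw [neg_div, Real.rpow_neg (by positivity), inv_pow, ← Real.rpow_natCast, ← Real.rpow_natCast,
        ← Real.rpow_mul (by positivity), ← Real.rpow_mul (by positivity), mul_comm ((k : ℝ) / 2)]
    rw [h5, neg_div, Real.rpow_neg (by positivity), ← div_eq_mul_inv, le_div_iff₀ (by positivity),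
      inv_mul_le_iff₀ (by positivity)]
    calc _ ≤ _ := h4
      _ = _ := by rw [mul_comm]; congr 2; ring
  · have : -q / (1 + a) = -q / (1 + 2 * a) - q * a / ((1 + a) * (1 + 2 * a)) := by
      field_simp
      ring
    have h6 : q * a / ((1 + a) * (1 + 2 * a)) ≤ a * q := by
      rw [div_le_iff₀ (by positivity)]
      nlinarith [mul_nonneg hq0 ha0.le, mul_nonneg (mul_nonneg hq0 ha0.le) ha0.le,
        mul_nonneg (mul_nonneg (mul_nonneg hq0 ha0.le) ha0.le) ha0.le]
    push_cast
    linarith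

lemma integrable_exp_neg_mul_sq_norm_obsLaw {k : ℕ} (s : ℝ) {t : ℝ} (ht : 0 ≤ t)
    (z : EuclideanSpace ℝ (Fin k)) :
    Integrable (fun x => Real.exp (-t * ‖x‖ ^ 2)) (obsLaw s z) := by
  refine Integrable.of_bound (by fun_prop) 1 (ae_of_all _ fun x => ?_)
  rw [Real.norm_of_nonneg (Real.exp_nonneg _), Real.exp_le_one_iff]
  have : 0 ≤ t * ‖x‖ ^ 2 := by positivity
  linarith

lemma tvDist_reweight_gaussDensity_le {k : ℕ} {s τ c : ℝ} (hs : 0 < s) (hτ : 0 < τ) (hc : 0 < c)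
    (z : EuclideanSpace ℝ (Fin k)) :
    tvDist (reweight (obsLaw s z) (fun x => ENNReal.ofReal (gaussDensity τ 0 x))) (obsLaw s z) ≤
      ENNReal.ofReal (c + (k * (s ^ 4 / τ ^ 4) / 2 + s ^ 2 / τ ^ 4 * ‖z‖ ^ 2) / c) := by
  have h1 : (fun x : EuclideanSpace ℝ (Fin k) => ENNReal.ofReal (gaussDensity τ 0 x)) =
      fun x => ENNReal.ofReal ((2 * Real.pi * τ ^ 2) ^ (-(k : ℝ) / 2)) *
        ENNReal.ofReal (Real.exp (-(1 / (2 * τ ^ 2)) * ‖x‖ ^ 2)) := by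
    funext x
    rw [← ENNReal.ofReal_mul (by positivity), gaussDensity, sub_zero]
    congr 3
    ring
  have hpos : 0 < (2 * Real.pi * τ ^ 2) ^ (-(k : ℝ) / 2) := by positivity
  rw [h1, reweight_const_mul _ (by fun_prop) (by simpa using hpos) (by simp)]
  have ht : 0 ≤ 1 / (2 * τ ^ 2) := by positivity
  refine tvDist_reweight_le_of_sq_integral_le (fun x => Real.exp_nonneg _)
    (integrable_exp_neg_mul_sq_norm_obsLaw s ht z) ?_ ?_ (by positivity) hc
    (sq_integral_exp_neg_sq_norm_obsLaw_le hs hτ.ne' z)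
  · refine (integrable_exp_neg_mul_sq_norm_obsLaw s (t := 1 / τ ^ 2) (by positivity) z).congr
      (ae_of_all _ fun x => ?_)
    simp only
    rw [← Real.exp_nat_mul]
    congr 1
    field_simp
    norm_num
  · rw [integral_exp_neg_sq_norm_obsLaw hs ht]
    positivity

/-- The second moment bound `2 k s² + 2 ‖z‖²` adds `2` to the coefficient `1 / 2` of `k s⁴ / τ⁴`,
whence `5 / 2`. -/
lemma lintegral_chiSq_bound_le {k : ℕ} {s τ c : ℝ} (hc : 0 < c)
    (z : EuclideanSpace ℝ (Fin k)) :
    ∫⁻ x, ENNReal.ofReal (c + (k * (s ^ 4 / τ ^ 4) / 2 + s ^ 2 / τ ^ 4 * ‖x‖ ^ 2) / c)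
      ∂(obsLaw s z) ≤
    ENNReal.ofReal (c + (5 / 2 * (k * (s ^ 4 / τ ^ 4)) + 2 * (s ^ 2 / τ ^ 4 * ‖z‖ ^ 2)) / c) := by
  have h : ∀ x : EuclideanSpace ℝ (Fin k),
      ENNReal.ofReal (c + (k * (s ^ 4 / τ ^ 4) / 2 + s ^ 2 / τ ^ 4 * ‖x‖ ^ 2) / c) =
      ENNReal.ofReal (c + k * (s ^ 4 / τ ^ 4) / 2 / c) +
        ENNReal.ofReal (s ^ 2 / τ ^ 4 / c) * ENNReal.ofReal (‖x‖ ^ 2) := by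
    intro x
    rw [← ENNReal.ofReal_mul (by positivity), ← ENNReal.ofReal_add (by positivity) (by positivity)]
    congr 1
    ring
  simp_rw [h]
  rw [lintegral_add_left measurable_const, lintegral_const_mul _ (by fun_prop), lintegral_const,
    measure_univ, mul_one]
  refine (add_le_add_right (mul_le_mul_right (lintegral_sq_norm_obsLaw_le s z) _) _).trans
    (le_of_eq ?_)
  rw [← ENNReal.ofReal_mul (by positivity), ← ENNReal.ofReal_add (by positivity) (by positivity)]
  congr 1
  ring

end GaussianPrior

/-! ### The smooth prior: change of variables and concentration. -/

section SmoothPrior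

lemma act_inv_act {k : ℕ} {T : Matrix (Fin k) (Fin k) ℝ} (hT : T.det ≠ 0)
    (x : EuclideanSpace ℝ (Fin k)) : act T⁻¹ (act T x) = x := by
  rw [← act_mul, Matrix.nonsing_inv_mul _ (isUnit_iff_ne_zero.2 hT), act_one]

lemma act_act_inv {k : ℕ} {T : Matrix (Fin k) (Fin k) ℝ} (hT : T.det ≠ 0)
    (x : EuclideanSpace ℝ (Fin k)) : act T (act T⁻¹ x) = x := by
  rw [← act_mul, Matrix.mul_nonsing_inv _ (isUnit_iff_ne_zero.2 hT), act_one]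

lemma withDensity_map_act {k : ℕ} {T : Matrix (Fin k) (Fin k) ℝ} (hT : T.det ≠ 0)
    {w : EuclideanSpace ℝ (Fin k) → ℝ≥0∞} (hw : Measurable w) :
    (volume.withDensity w).map (act T) =
      volume.withDensity (fun x => ENNReal.ofReal |T.det|⁻¹ * w (act T⁻¹ x)) := by
  have hm : Measurable fun x => w (act T⁻¹ x) := hw.comp (measurable_act _)
  ext s hs
  rw [Measure.map_apply (measurable_act T) hs, withDensity_apply _ (measurable_act T hs),
    withDensity_apply _ hs, lintegral_const_mul _ hm]
  have h := setLIntegral_map (μ := volume) hs hm (measurable_act T)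
  simp only [act_inv_act hT] at h
  rw [← h, Measure.map_linearMap_addHaar_eq_smul_addHaar _ (by rwa [LinearMap.det_toLpLin]),
    LinearMap.det_toLpLin,
    Measure.restrict_smul, lintegral_smul_measure, abs_inv, smul_eq_mul]

/-- Dropping `2 π ≥ 1` leaves the power `σ^k` that occurs in the condition on `w(θ₀)`. -/
lemma two_pi_mul_sq_rpow_le {k : ℕ} {s : ℝ} (hs : 0 < s) :
    (2 * Real.pi * s ^ 2) ^ (-(k : ℝ) / 2) ≤ (s ^ k)⁻¹ := by
  have h1 : ((s ^ 2) ^ ((k : ℝ) / 2)) = s ^ k := by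
    rw [← Real.rpow_natCast, ← Real.rpow_natCast, ← Real.rpow_mul hs.le]
    congr 1
    push_cast
    ring
  rw [neg_div, Real.rpow_neg (by positivity), ← h1]
  refine inv_anti₀ (by positivity) (Real.rpow_le_rpow (by positivity) ?_ (by positivity))
  have := Real.pi_gt_three
  nlinarith [sq_nonneg s]

/-- For `z` within half the radius of `z₀`, points off the ball are at squared distance at least `σ²
M / 4` from `z`: Chebyshev gives them Gaussian mass at most `4 k / M`, and the exponent of the
density there is at most `-M / 8`. The last summand is the price of a distant `z`. -/
lemma tvDist_reweight_smooth_le {k : ℕ} {σ M : ℝ} (hσ : 0 < σ) (hM : 0 < M) (hkM : 4 * k / M < 1)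
    {v : EuclideanSpace ℝ (Fin k) → ℝ≥0∞} (hv : Measurable v) (hv1 : ∫⁻ x, v x ≤ 1)
    (z₀ : EuclideanSpace ℝ (Fin k)) {w r : ℝ} (hw : 0 < w) (hr : 1 ≤ r)
    (hlow : ∀ x, ‖x - z₀‖ ^ 2 ≤ σ ^ 2 * M → ENNReal.ofReal (w / r) ≤ v x)
    (hup : ∀ x, ‖x - z₀‖ ^ 2 ≤ σ ^ 2 * M → v x ≤ ENNReal.ofReal (r * w))
    (z : EuclideanSpace ℝ (Fin k)) :
    tvDist (reweight (obsLaw σ z) v) (obsLaw σ z) ≤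
      ENNReal.ofReal (r ^ 2 / (1 - 4 * k / M) - 1 +
        r * (Real.exp (-(M / 8)) / (σ ^ k * w)) / (1 - 4 * k / M)) +
      ENNReal.ofReal (4 / (σ ^ 2 * M)) * ENNReal.ofReal (‖z - z₀‖ ^ 2) := by
  -- For distant `z` the last summand alone is at least one.
  rcases le_or_gt (‖z - z₀‖ ^ 2) (σ ^ 2 * M / 4) with hz | hz
  swap
  · refine (tvDist_le_one (reweight_univ_le _ _) (by simp)).trans (le_add_left ?_)
    rw [← ENNReal.ofReal_mul (by positivity), ← ENNReal.ofReal_one]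
    refine ENNReal.ofReal_le_ofReal ?_
    rw [div_mul_eq_mul_div, le_div_iff₀ (by positivity)]
    linarith
  refine le_add_right ?_
  set B : Set (EuclideanSpace ℝ (Fin k)) := {x | ‖x - z₀‖ ^ 2 ≤ σ ^ 2 * M} with hB
  have hBm : MeasurableSet B := measurableSet_le (by fun_prop) measurable_const
  have hfar : ∀ x ∈ Bᶜ, σ ^ 2 * M / 4 ≤ ‖x - z‖ ^ 2 := by
    intro x hx
    have hx' : σ ^ 2 * M < ‖x - z₀‖ ^ 2 := not_le.1 hx
    have h1 : ‖x - z₀‖ ≤ ‖x - z‖ + ‖z - z₀‖ := norm_sub_le_norm_sub_add_norm_sub x z z₀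
    nlinarith [sq_nonneg (‖x - z‖ - ‖z - z₀‖), norm_nonneg (x - z₀)]
  have hε : 0 ≤ 4 * k / M := by positivity
  have hgap : 0 < 1 - 4 * k / M := by linarith
  refine tvDist_reweight_le_of_flat hBm hw (by linarith) (fun x hx => hlow x hx)
    (fun x hx => hup x hx) hkM ?_ (by positivity) ?_ ?_
  · have hc : 0 < σ ^ 2 * M / 4 := by positivity
    have h1 : ENNReal.ofReal (σ ^ 2 * M / 4) * (obsLaw σ z) Bᶜ ≤ ENNReal.ofReal (k * σ ^ 2) := by
      rw [← lintegral_sq_norm_sub_obsLaw σ z, ← setLIntegral_const]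
      exact (setLIntegral_mono' hBm.compl fun x hx => ENNReal.ofReal_le_ofReal (hfar x hx)).trans
        (setLIntegral_le_lintegral _ _)
    rw [← ofReal_measureReal, ← ENNReal.ofReal_mul hc.le,
      ENNReal.ofReal_le_ofReal_iff (by positivity)] at h1
    rw [le_div_iff₀ hM]
    have hσ2 : 0 < σ ^ 2 := by positivity
    refine le_of_mul_le_mul_left ?_ hσ2
    linarith
  · rw [obsLaw_eq_withDensity hσ, setLIntegral_withDensity_eq_setLIntegral_mul _
      (continuous_gaussDensity_right σ z).measurable.ennreal_ofReal hv hBm.compl]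
    have hd : ∀ x ∈ Bᶜ, gaussDensity σ z x ≤ w * (Real.exp (-(M / 8)) / (σ ^ k * w)) := by
      intro x hx
      have e : w * (Real.exp (-(M / 8)) / (σ ^ k * w)) = (σ ^ k)⁻¹ * Real.exp (-(M / 8)) := by
        field_simp
      rw [e, gaussDensity]
      refine mul_le_mul (two_pi_mul_sq_rpow_le hσ) (Real.exp_le_exp.2 ?_) (Real.exp_nonneg _)
        (by positivity)
      rw [neg_div, neg_le_neg_iff, le_div_iff₀ (by positivity)]
      linarith [hfar x hx]
    calc ∫⁻ x in Bᶜ, ((fun x => ENNReal.ofReal (gaussDensity σ z x)) * v) x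
        ≤ ∫⁻ x in Bᶜ, ENNReal.ofReal (w * (Real.exp (-(M / 8)) / (σ ^ k * w))) * v x :=
          setLIntegral_mono' hBm.compl fun x hx =>
            mul_le_mul_left (ENNReal.ofReal_le_ofReal (hd x hx)) _
      _ ≤ ∫⁻ x, ENNReal.ofReal (w * (Real.exp (-(M / 8)) / (σ ^ k * w))) * v x :=
          setLIntegral_le_lintegral _ _
      _ ≤ ENNReal.ofReal (w * (Real.exp (-(M / 8)) / (σ ^ k * w))) := by
          rw [lintegral_const_mul _ hv]
          exact mul_le_of_le_one_right' hv1
  · rw [one_le_div hgap]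
    nlinarith

end SmoothPrior

/-! ### Non-asymptotic bounds for both kinds of prior. -/

lemma inducedPrior_mul {n k : ℕ} (U : Matrix (Fin n) (Fin k) ℝ) (T : Matrix (Fin k) (Fin k) ℝ)
    (Wt : Measure (EuclideanSpace ℝ (Fin k))) :
    inducedPrior (U * T) Wt = (Wt.map (act T)).map (act U) := by
  rw [Measure.map_map (measurable_act _) (measurable_act _), inducedPrior]
  congr 1
  funext x
  rw [act_mul, Function.comp_apply]

/-- A quantitative Bernstein-von Mises theorem for isotropic Gaussian priors. -/
lemma lintegral_tvDist_gaussianPrior_le {n k p : ℕ} {Φ : Matrix (Fin n) (Fin k) ℝ}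
    (hΦ : LinearIndependent ℝ Φ.col) {σ : ℝ} (hσ : 0 < σ) (F₀ : EuclideanSpace ℝ (Fin n))
    (Wt : Measure (EuclideanSpace ℝ (Fin k))) [IsProbabilityMeasure Wt]
    (G : Matrix (Fin p) (Fin n) ℝ) {τ : ℝ} (hτ : τ ≠ 0)
    (hW : inducedPrior Φ Wt = multivariateGaussian 0 (τ ^ 2 • projMat Φ)) {c : ℝ} (hc : 0 < c) :
    ∫⁻ y, tvDist (posteriorOf σ (inducedPrior Φ Wt) G y)
      (multivariateGaussian (act G (act (projMat Φ) y)) (σ ^ 2 • (G * projMat Φ * Gᵀ)))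
      ∂(obsLaw σ F₀) ≤
    ENNReal.ofReal (c + (5 / 2 * (k * (σ ^ 4 / τ ^ 4)) + 2 * (σ ^ 2 / τ ^ 4 * ‖F₀‖ ^ 2)) / c) := by
  obtain ⟨U, T, hU, hT, rfl⟩ := exists_orthonormal_mul_invertible Φ hΦ
  have hτ' : 0 < |τ| := abs_pos.2 hτ
  have hτ4 : |τ| ^ 4 = τ ^ 4 := by
    rw [show (4 : ℕ) = 2 * 2 from rfl, pow_mul, sq_abs, ← pow_mul]
  rw [projMat_mul hU hT] at hW ⊢
  have hW' : inducedPrior (U * T) Wt =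
      (volume.withDensity fun x => ENNReal.ofReal (gaussDensity |τ| 0 x)).map (act U) := by
    rw [← obsLaw_eq_withDensity hτ', obsLaw_map_act, hW, map_zero, sq_abs]
  refine (lintegral_tvDist_posteriorOf_le hU hσ
    (continuous_gaussDensity_right |τ| 0).measurable.ennreal_ofReal _ hW' F₀ G (by fun_prop)
    (tvDist_reweight_gaussDensity_le hσ hτ' hc)).trans ((lintegral_chiSq_bound_le hc _).trans ?_)
  rw [hτ4]
  have := norm_act_transpose_le hU F₀
  refine ENNReal.ofReal_le_ofReal ?_
  gcongr

lemma div_le_oscRatio {n k : ℕ} {Φ : Matrix (Fin n) (Fin k) ℝ}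
    (w : EuclideanSpace ℝ (Fin k) → ℝ≥0) (θ₀ : EuclideanSpace ℝ (Fin k)) {r : ℝ}
    {h g : EuclideanSpace ℝ (Fin k)} (hh : ‖act Φ h‖ ^ 2 ≤ r) (hg : ‖act Φ g‖ ^ 2 ≤ r) :
    (w (θ₀ + h) : ℝ≥0∞) / w (θ₀ + g) ≤ oscRatio Φ w θ₀ r := by
  unfold oscRatio
  refine le_trans ?_ (le_iSup₂ h hh)
  exact le_iSup₂ (f := fun (g : EuclideanSpace ℝ (Fin k)) (_ : ‖act Φ g‖ ^ 2 ≤ r) =>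
    (w (θ₀ + h) : ℝ≥0∞) / w (θ₀ + g)) g hg

/-- A quantitative Bernstein-von Mises theorem for smooth priors. -/
lemma lintegral_tvDist_smoothPrior_le {n k p : ℕ} {Φ : Matrix (Fin n) (Fin k) ℝ}
    (hΦ : LinearIndependent ℝ Φ.col) {σ : ℝ} (hσ : 0 < σ) (F₀ : EuclideanSpace ℝ (Fin n))
    (Wt : Measure (EuclideanSpace ℝ (Fin k))) [IsProbabilityMeasure Wt]
    (G : Matrix (Fin p) (Fin n) ℝ) {w : EuclideanSpace ℝ (Fin k) → ℝ≥0} (hwm : Measurable w)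
    (hW : Wt = volume.withDensity (fun θ => (w θ : ℝ≥0∞))) {M : ℝ} (hM : 0 < M)
    (hkM : 4 * k / M < 1) {r : ℝ}
    (hosc : oscRatio Φ w (projParam Φ F₀) (σ ^ 2 * M) ≤ ENNReal.ofReal r)
    (hw0 : w (projParam Φ F₀) ≠ 0) :
    ∫⁻ y, tvDist (posteriorOf σ (inducedPrior Φ Wt) G y)
      (multivariateGaussian (act G (act (projMat Φ) y)) (σ ^ 2 • (G * projMat Φ * Gᵀ)))
      ∂(obsLaw σ F₀) ≤
    ENNReal.ofReal (r ^ 2 / (1 - 4 * k / M) - 1 + r * (Real.exp (-(M / 8)) *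
      (Real.sqrt (Φᵀ * Φ).det / (σ ^ k * (w (projParam Φ F₀) : ℝ)))) / (1 - 4 * k / M)) +
    ENNReal.ofReal (4 * k / M) := by
  obtain ⟨U, T, hU, hT, rfl⟩ := exists_orthonormal_mul_invertible Φ hΦ
  rw [projMat_mul hU hT, det_gram_mul hU, Real.sqrt_sq_eq_abs]
  set θ₀ := projParam (U * T) F₀ with hθ
  set z₀ := act Uᵀ F₀ with hz
  have hTθ : act T θ₀ = z₀ := act_projParam_mul hU hT F₀
  have hdet : 0 < |T.det| := abs_pos.2 hT
  have hwpos : 0 < (w θ₀ : ℝ) := NNReal.coe_pos.2 (pos_iff_ne_zero.2 hw0)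
  have hratio : ∀ h, ‖act (U * T) h‖ ^ 2 ≤ σ ^ 2 * M → ∀ g, ‖act (U * T) g‖ ^ 2 ≤ σ ^ 2 * M →
      (w (θ₀ + h) : ℝ≥0∞) / w (θ₀ + g) ≤ ENNReal.ofReal r := fun h hh g hg =>
    (div_le_oscRatio w θ₀ hh hg).trans hosc
  have hzero : ‖act (U * T) (0 : EuclideanSpace ℝ (Fin k))‖ ^ 2 ≤ σ ^ 2 * M := by
    rw [map_zero, norm_zero]
    have := mul_pos (pow_pos hσ 2) hM
    linarith [zero_pow (M₀ := ℝ) two_ne_zero]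
  have hw0' : (w θ₀ : ℝ≥0∞) ≠ 0 := by simpa using hw0
  have hr : 1 ≤ r := by
    have := hratio 0 hzero 0 hzero
    rwa [add_zero, ENNReal.div_self hw0' ENNReal.coe_ne_top, ENNReal.one_le_ofReal] at this
  set v : EuclideanSpace ℝ (Fin k) → ℝ≥0∞ :=
    fun x => ENNReal.ofReal |T.det|⁻¹ * (w (act T⁻¹ x) : ℝ≥0∞) with hv
  have hvm : Measurable v :=
    (hwm.coe_nnreal_ennreal.comp (measurable_act _)).const_mul _
  have hmapT : Wt.map (act T) = volume.withDensity v := by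
    rw [hW]; exact withDensity_map_act hT hwm.coe_nnreal_ennreal
  have hv1 : ∫⁻ x, v x ≤ 1 := by
    rw [← setLIntegral_univ, ← withDensity_apply _ MeasurableSet.univ, ← hmapT,
      Measure.map_apply (measurable_act T) MeasurableSet.univ]
    exact prob_le_one
  -- As `‖Φ h‖ = ‖T h‖`, the ellipsoid around `θ₀` becomes the ball around `z₀`.
  have hpoint : ∀ x, ‖x - z₀‖ ^ 2 ≤ σ ^ 2 * M → ∃ h, ‖act (U * T) h‖ ^ 2 ≤ σ ^ 2 * M ∧
      act T⁻¹ x = θ₀ + h := by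
    intro x hx
    refine ⟨act T⁻¹ x - θ₀, ?_, by abel⟩
    rwa [act_mul, norm_act hU, map_sub, act_act_inv hT, hTθ]
  have hreal : ∀ a : ℝ≥0, ENNReal.ofReal |T.det|⁻¹ * (a : ℝ≥0∞) =
      ENNReal.ofReal (|T.det|⁻¹ * a) := by
    intro a
    rw [ENNReal.ofReal_mul (by positivity), ENNReal.ofReal_coe_nnreal]
  have hcomp : ∀ a b : ℝ≥0, b ≠ 0 → (a : ℝ≥0∞) / b ≤ ENNReal.ofReal r → (a : ℝ) ≤ r * b := by
    intro a b hb hab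
    rw [ENNReal.div_le_iff (by simpa using hb) ENNReal.coe_ne_top, ← ENNReal.ofReal_coe_nnreal,
      ← ENNReal.ofReal_coe_nnreal, ← ENNReal.ofReal_mul (by linarith),
      ENNReal.ofReal_le_ofReal_iff (by positivity)] at hab
    exact hab
  -- A zero of `w` on the ellipsoid would make the ratio `w θ₀ / 0 = ∞`, contradicting the finite
  -- bound `r`.
  have hne : ∀ h, ‖act (U * T) h‖ ^ 2 ≤ σ ^ 2 * M → w (θ₀ + h) ≠ 0 := by
    intro h hh h0
    have := hratio 0 hzero h hh
    rw [h0, ENNReal.coe_zero, add_zero, ENNReal.div_zero hw0'] at this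
    exact ENNReal.ofReal_ne_top (top_le_iff.1 this)
  have hlow : ∀ x, ‖x - z₀‖ ^ 2 ≤ σ ^ 2 * M →
      ENNReal.ofReal (|T.det|⁻¹ * w θ₀ / r) ≤ v x := by
    intro x hx
    obtain ⟨h, hh, hxh⟩ := hpoint x hx
    rw [hv]
    simp only [hxh, hreal]
    refine ENNReal.ofReal_le_ofReal ?_
    rw [mul_div_assoc]
    refine mul_le_mul_of_nonneg_left ?_ (by positivity)
    rw [div_le_iff₀ (by linarith), mul_comm]
    simpa using hcomp _ _ (hne h hh) (hratio 0 hzero h hh)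
  have hup : ∀ x, ‖x - z₀‖ ^ 2 ≤ σ ^ 2 * M →
      v x ≤ ENNReal.ofReal (r * (|T.det|⁻¹ * w θ₀)) := by
    intro x hx
    obtain ⟨h, hh, hxh⟩ := hpoint x hx
    rw [hv]
    simp only [hxh, hreal]
    refine ENNReal.ofReal_le_ofReal ?_
    rw [mul_left_comm]
    refine mul_le_mul_of_nonneg_left ?_ (by positivity)
    have := hratio h hh 0 hzero
    rw [add_zero] at this
    exact hcomp _ _ hw0 this
  have hmain := lintegral_tvDist_posteriorOf_le hU hσ hvm (inducedPrior (U * T) Wt)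
    (by rw [inducedPrior_mul, hmapT]) F₀ G (by fun_prop)
    (tvDist_reweight_smooth_le hσ hM hkM hvm hv1 z₀ (w := |T.det|⁻¹ * w θ₀) (by positivity) hr
      hlow hup)
  refine hmain.trans (le_of_eq ?_)
  rw [lintegral_add_left measurable_const, lintegral_const_mul _ (by fun_prop), lintegral_const,
    measure_univ, mul_one, lintegral_sq_norm_sub_obsLaw, ← ENNReal.ofReal_mul (by positivity)]
  congr 2
  · congr 3
    field_simp
  · field_simp

/-! ### Passage to the limit. -/

lemma isLittleO_natCast_of_mul_log {k : ℕ → ℕ} {M : ℕ → ℝ} (hM : Tendsto M atTop atTop)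
    (h : (fun n => (k n : ℝ) * Real.log (k n)) =o[atTop] M) :
    (fun n => (k n : ℝ)) =o[atTop] M := by
  have h3 : (fun _ : ℕ => (3 : ℝ)) =o[atTop] M :=
    Asymptotics.isLittleO_const_left.2 (Or.inr (tendsto_norm_atTop_atTop.comp hM))
  -- The comparison is `k ≤ 3 + k log k`: the constant covers `k ≤ 3`, and `log k ≥ 1` beyond
  -- because `e < 3`.
  refine Asymptotics.IsBigO.trans_isLittleO (Asymptotics.IsBigO.of_bound 1
    (Eventually.of_forall fun n => ?_)) (h3.add h)
  have h0 : 0 ≤ (k n : ℝ) * Real.log (k n) :=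
    mul_nonneg (Nat.cast_nonneg _) (Real.log_natCast_nonneg _)
  rw [one_mul, Real.norm_of_nonneg (Nat.cast_nonneg _), Real.norm_of_nonneg (by linarith)]
  rcases le_or_gt (k n) 3 with hk | hk
  · have : (k n : ℝ) ≤ 3 := by exact_mod_cast hk
    linarith
  · have hk' : (3 : ℝ) ≤ k n := by exact_mod_cast hk.le
    have : 1 ≤ Real.log (k n) := by
      rw [Real.le_log_iff_exp_le (by linarith)]
      linarith [Real.exp_one_lt_d9]
    nlinarith

/-- If `w θ₀ = 0`, taking `g = 0` gives `∞` unless `w` vanishes on the whole ellipsoid, and then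
every quotient is `0 / 0 = 0`. A supremum close to `1` excludes both. -/
lemma apply_ne_zero_of_oscRatio {n k : ℕ} {Φ : Matrix (Fin n) (Fin k) ℝ}
    {w : EuclideanSpace ℝ (Fin k) → ℝ≥0} {θ₀ : EuclideanSpace ℝ (Fin k)} {r : ℝ} (hr : 0 ≤ r)
    (h0 : oscRatio Φ w θ₀ r ≠ 0) (h1 : oscRatio Φ w θ₀ r ≠ ∞) : w θ₀ ≠ 0 := by
  intro hw
  have hzero : ‖act Φ (0 : EuclideanSpace ℝ (Fin k))‖ ^ 2 ≤ r := by simpa using hr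
  have hall : ∀ h, ‖act Φ h‖ ^ 2 ≤ r → (w (θ₀ + h) : ℝ≥0∞) = 0 := by
    intro h hh
    by_contra hne
    have : (w (θ₀ + h) : ℝ≥0∞) / w (θ₀ + 0) ≤ oscRatio Φ w θ₀ r :=
      div_le_oscRatio w θ₀ hh hzero
    rw [add_zero, hw, ENNReal.coe_zero, ENNReal.div_zero hne] at this
    exact h1 (top_le_iff.1 this)
  refine h0 (le_antisymm (iSup₂_le fun h hh => iSup₂_le fun g _ => ?_) bot_le)
  rw [hall h hh, ENNReal.zero_div]

theorem tendsto_lintegral_tvDist_gaussianPrior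
    (k : ℕ → ℕ) (Φ : ∀ n, Matrix (Fin n) (Fin (k n)) ℝ)
    (hΦ : ∀ n, LinearIndependent ℝ (Φ n).col) (σ : ℕ → ℝ) (hσ : ∀ n, 0 < σ n)
    (F₀ : ∀ n, EuclideanSpace ℝ (Fin n))
    (Wt : ∀ n, Measure (EuclideanSpace ℝ (Fin (k n)))) [∀ n, IsProbabilityMeasure (Wt n)]
    (p : ℕ) (G : ∀ n, Matrix (Fin p) (Fin n) ℝ) (h : GaussianPriorConditions k Φ σ F₀ Wt) :
    Tendsto (fun n => ∫⁻ y, tvDist (posteriorOf (σ n) (inducedPrior (Φ n) (Wt n)) (G n) y)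
        (multivariateGaussian (act (G n) (act (projMat (Φ n)) y))
          (σ n ^ 2 • (G n * projMat (Φ n) * (G n)ᵀ))) ∂(obsLaw (σ n) (F₀ n))) atTop (𝓝 0) := by
  obtain ⟨τ, hW, hστ, hF, hk⟩ := h
  have hτ0 : ∀ᶠ n in atTop, τ n ≠ 0 := by
    filter_upwards [hστ.bound one_pos] with n hn h0
    rw [h0, norm_zero, mul_zero, norm_le_zero_iff] at hn
    exact (hσ n).ne' hn
  set x : ℕ → ℝ := fun n => 5 / 2 * (k n * (σ n ^ 4 / τ n ^ 4)) +
    2 * (σ n ^ 2 / τ n ^ 4 * ‖F₀ n‖ ^ 2) with hx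
  have hx0 : ∀ n, 0 ≤ x n := fun n => by positivity
  -- The summands are multiples of the ratio in the condition on `k` and of the square of the ratio
  -- in the condition on `‖F₀‖`.
  have hxt : Tendsto x atTop (𝓝 0) := by
    have h1 := (hk.tendsto_div_nhds_zero).const_mul (5 / 2)
    have h2 := (hF.tendsto_div_nhds_zero.pow 2).const_mul 2
    have h3 := h1.add h2
    simp only [mul_zero, ne_eq, OfNat.ofNat_ne_zero, not_false_eq_true, zero_pow, add_zero] at h3
    refine h3.congr fun n => ?_
    rw [hx]
    simp only
    congr 2
    · rw [div_div_eq_mul_div, mul_div_assoc]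
    · rw [div_div_eq_mul_div, div_pow, mul_pow]
      ring
  -- Choosing `c` near `√x` balances `c` and `x / c`; the term `1 / (n + 1)` keeps `c` positive when
  -- `x` vanishes, and `x ≤ c²` still gives `x / c ≤ c`.
  set c : ℕ → ℝ := fun n => Real.sqrt (x n + 1 / ((n : ℝ) + 1)) with hc
  have hcpos : ∀ n, 0 < c n := fun n => Real.sqrt_pos.2 (by have := hx0 n; positivity)
  have hct : Tendsto c atTop (𝓝 0) := by
    have := (hxt.add tendsto_one_div_add_atTop_nhds_zero_nat).sqrt
    rwa [add_zero, Real.sqrt_zero] at this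
  have hbt : Tendsto (fun n => ENNReal.ofReal (c n + c n)) atTop (𝓝 0) := by
    have := ENNReal.tendsto_ofReal (hct.add hct)
    simpa using this
  refine tendsto_of_tendsto_of_tendsto_of_le_of_le' tendsto_const_nhds hbt
    (Eventually.of_forall fun _ => bot_le) ?_
  filter_upwards [hτ0] with n hn
  refine (lintegral_tvDist_gaussianPrior_le (hΦ n) (hσ n) (F₀ n) (Wt n) (G n) hn (hW n)
    (hcpos n)).trans (ENNReal.ofReal_le_ofReal (add_le_add_right ?_ _))
  rw [div_le_iff₀ (hcpos n), Real.mul_self_sqrt (by have := hx0 n; positivity)]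
  have : (0 : ℝ) ≤ 1 / ((n : ℝ) + 1) := by positivity
  change x n ≤ _
  linarith

theorem tendsto_lintegral_tvDist_smoothPrior
    (k : ℕ → ℕ) (Φ : ∀ n, Matrix (Fin n) (Fin (k n)) ℝ)
    (hΦ : ∀ n, LinearIndependent ℝ (Φ n).col) (σ : ℕ → ℝ) (hσ : ∀ n, 0 < σ n)
    (F₀ : ∀ n, EuclideanSpace ℝ (Fin n))
    (Wt : ∀ n, Measure (EuclideanSpace ℝ (Fin (k n)))) [∀ n, IsProbabilityMeasure (Wt n)]
    (p : ℕ) (G : ∀ n, Matrix (Fin p) (Fin n) ℝ) (h : SmoothPriorConditions k Φ σ F₀ Wt) :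
    Tendsto (fun n => ∫⁻ y, tvDist (posteriorOf (σ n) (inducedPrior (Φ n) (Wt n)) (G n) y)
        (multivariateGaussian (act (G n) (act (projMat (Φ n)) y))
          (σ n ^ 2 • (G n * projMat (Φ n) * (G n)ᵀ))) ∂(obsLaw (σ n) (F₀ n))) atTop (𝓝 0) := by
  obtain ⟨w, M, hwm, hW, hM, hosc, hklog, hlog⟩ := h
  have hkM := isLittleO_natCast_of_mul_log hM hklog
  set r : ℕ → ℝ := fun n =>
    (oscRatio (Φ n) (w n) (projParam (Φ n) (F₀ n)) (σ n ^ 2 * M n)).toReal with hr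
  have hrt : Tendsto r atTop (𝓝 1) := by
    have := (ENNReal.tendsto_toReal ENNReal.one_ne_top).comp hosc
    rwa [ENNReal.toReal_one] at this
  have hε : Tendsto (fun n => 4 * (k n : ℝ) / M n) atTop (𝓝 0) := by
    have := hkM.tendsto_div_nhds_zero.const_mul 4
    simpa [mul_div_assoc] using this
  have he : Tendsto (fun n => Real.exp (-(M n / 16))) atTop (𝓝 0) :=
    Real.tendsto_exp_neg_atTop_nhds_zero.comp (hM.atTop_div_const (by norm_num))
  have hD : Tendsto (fun n => ENNReal.ofReal (r n ^ 2 / (1 - 4 * k n / M n) - 1 +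
      r n * Real.exp (-(M n / 16)) / (1 - 4 * k n / M n)) + ENNReal.ofReal (4 * k n / M n))
      atTop (𝓝 0) := by
    have h1 : Tendsto (fun n => 1 - 4 * (k n : ℝ) / M n) atTop (𝓝 1) := by
      simpa using hε.const_sub 1
    have h2 := (((hrt.pow 2).div h1 one_ne_zero).sub_const 1).add
      ((hrt.mul he).div h1 one_ne_zero)
    have h3 := (ENNReal.tendsto_ofReal h2).add (ENNReal.tendsto_ofReal hε)
    simpa using h3
  refine tendsto_of_tendsto_of_tendsto_of_le_of_le' tendsto_const_nhds hD
    (Eventually.of_forall fun _ => bot_le) ?_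
  filter_upwards [hM.eventually_gt_atTop 0, hε.eventually_lt_const zero_lt_one,
    hosc.eventually_ne ENNReal.one_ne_top, hosc.eventually_ne one_ne_zero,
    hlog.bound (show (0 : ℝ) < 1 / 16 by norm_num)] with n hMn hεn hfin hne hlogn
  have hw0 : w n (projParam (Φ n) (F₀ n)) ≠ 0 :=
    apply_ne_zero_of_oscRatio (by positivity) hne hfin
  refine (lintegral_tvDist_smoothPrior_le (hΦ n) (hσ n) (F₀ n) (Wt n) (G n) (hwm n) (hW n) hMn hεn
    (r := r n) (ENNReal.ofReal_toReal hfin).ge hw0).trans ?_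
  have hgap : 0 < 1 - 4 * (k n : ℝ) / M n := by linarith
  have hrn : 0 ≤ r n := ENNReal.toReal_nonneg
  refine add_le_add_left (ENNReal.ofReal_le_ofReal (add_le_add_right ?_ _)) _
  refine div_le_div_of_nonneg_right (mul_le_mul_of_nonneg_left ?_ hrn) hgap.le
  set L := Real.sqrt ((Φ n)ᵀ * Φ n).det /
    (σ n ^ k n * (w n (projParam (Φ n) (F₀ n)) : ℝ)) with hL
  rw [Real.norm_of_nonneg (le_max_left _ _), Real.norm_of_nonneg hMn.le] at hlogn
  -- The log condition is used with constant `1 / 16`, half of the available `1 / 8`, so that a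
  -- factor `exp(-M / 16)` survives.
  have hL1 : L ≤ Real.exp (M n / 16) := by
    refine (Real.le_exp_log L).trans (Real.exp_le_exp.2 ?_)
    linarith [le_max_right 0 (Real.log L)]
  calc Real.exp (-(M n / 8)) * L ≤ Real.exp (-(M n / 8)) * Real.exp (M n / 16) :=
        mul_le_mul_of_nonneg_left hL1 (Real.exp_nonneg _)
    _ = Real.exp (-(M n / 16)) := by rw [← Real.exp_add]; congr 1; ring

end GaussianRegression

theorem corollary1
    -- dimensions of the sieve, linearly independent regressors (so `k n ≤ n`), noise levels
    (k : ℕ → ℕ) (Φ : ∀ n, Matrix (Fin n) (Fin (k n)) ℝ)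
    (hΦ : ∀ n, LinearIndependent ℝ (Φ n).col)
    (σ : ℕ → ℝ) (hσ : ∀ n, 0 < σ n)
    -- true mean vectors and priors on the parameter `θ`
    (F₀ : ∀ n, EuclideanSpace ℝ (Fin n))
    (Wt : ∀ n, Measure (EuclideanSpace ℝ (Fin (k n)))) [∀ n, IsProbabilityMeasure (Wt n)]
    -- the linear functionals
    (p : ℕ) (G : ∀ n, Matrix (Fin p) (Fin n) ℝ)
    (hprior : GaussianRegression.GaussianPriorConditions k Φ σ F₀ Wt ∨
      GaussianRegression.SmoothPriorConditions k Φ σ F₀ Wt) :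
    Tendsto (fun n => ∫⁻ y, GaussianRegression.tvDist
        (GaussianRegression.posteriorOf (σ n)
          (GaussianRegression.inducedPrior (Φ n) (Wt n)) (G n) y)
        (multivariateGaussian
          (GaussianRegression.act (G n)
            (GaussianRegression.act (GaussianRegression.projMat (Φ n)) y))
          (σ n ^ 2 • (G n * GaussianRegression.projMat (Φ n) * (G n)ᵀ)))
        ∂(GaussianRegression.obsLaw (σ n) (F₀ n))) atTop (𝓝 0) ∧
    ∀ n, (GaussianRegression.obsLaw (σ n) (F₀ n)).map
        (fun y => GaussianRegression.act (G n)
          (GaussianRegression.act (GaussianRegression.projMat (Φ n)) y)) =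
      multivariateGaussian
        (GaussianRegression.act (G n)
          (GaussianRegression.act (GaussianRegression.projMat (Φ n)) (F₀ n)))
        (σ n ^ 2 • (G n * GaussianRegression.projMat (Φ n) * (G n)ᵀ)) := by
  refine ⟨?_, fun n => ?_⟩
  · rcases hprior with h | h
    · exact GaussianRegression.tendsto_lintegral_tvDist_gaussianPrior k Φ hΦ σ hσ F₀ Wt p G h
    · exact GaussianRegression.tendsto_lintegral_tvDist_smoothPrior k Φ hΦ σ hσ F₀ Wt p G h
  · obtain ⟨U, T, hU, hT, hUT⟩ := GaussianRegression.exists_orthonormal_mul_invertible (Φ n) (hΦ n)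
    have h : (fun y => GaussianRegression.act (G n) (GaussianRegression.act (U * Uᵀ) y)) =
        GaussianRegression.act (G n * (U * Uᵀ)) := by
      funext y
      rw [← GaussianRegression.act_mul]
    -- `Π` is symmetric and idempotent, so the covariance `G Π (G Π)ᵀ` collapses to `G Π Gᵀ`.
    have hproj : U * Uᵀ * (U * Uᵀ)ᵀ = U * Uᵀ := by
      rw [Matrix.transpose_mul, Matrix.transpose_transpose, Matrix.mul_assoc, ← Matrix.mul_assoc Uᵀ,
        hU, Matrix.one_mul]
    rw [hUT, GaussianRegression.projMat_mul hU hT, h, GaussianRegression.obsLaw_map_act,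
      GaussianRegression.act_mul, Matrix.transpose_mul, Matrix.mul_assoc (G n),
      ← Matrix.mul_assoc (U * Uᵀ), hproj, ← Matrix.mul_assoc]
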